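/- Let $\mathfrak g$ be a split real form of a complex simple Lie algebra, and let $G=\operatorname{Int}(\mathfrak g)$ be its connected adjoint group, i.e. the analytic subgroup of $\operatorname{GL}(\mathfrak g)$ with Lie algebra $\operatorname{ad}\mathfrak g\cong\mathfrak g$ (equivalently, $G$ is the connected split real form of a complex simple adjoint Lie group, e.g. $\operatorname{PSL}_n(\mathbb R)$ for $n\ge 2$). Let $\theta$ be a Cartan involution of $\mathfrak g$ with eigenspace decomposition $\mathfrak g=\mathfrak k\oplus\mathfrak p$ ($\theta=+1$ on $\mathfrak k$, $\theta=-1$ on $\mathfrak p$), let $\mathfrak a\subset\mathfrak p$ be a maximal abelian subalgebra, choose an ordering on the set $\Pi\subset\mathfrak a^*\setminus\{0\}$ of restricted roots, let $\Delta$ be the set of simple roots, and let $\mathfrak a^+=\{A\in\mathfrak a : \beta(A)>0\text{ for all }\beta\in\Delta\}$, with closure $\overline{\mathfrak a^+}$. Every $x\in G$ can be written uniquely as a product $x=x_kx_hx_u$ of commuting elements, where $x_k$ is conjugate into the analytic subgroup of $G$ with Lie algebra $\mathfrak k$, $x_h$ is conjugate into $\exp\overline{\mathfrak a^+}$, and $x_u$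 is unipotent. The Jordan projection $\lambda:G\to\overline{\mathfrak a^+}$ sends $x$ to the unique $\lambda(x)\in\overline{\mathfrak a^+}$ such that $\exp\lambda(x)$ is conjugate to $x_h$. An element of $G$ is purely loxodromic if it is conjugate into $\exp\mathfrak a^+$. Let $U\subset G$ be the set of purely loxodromic elements. Then (i) $U$ is open in $G$; (ii) $\lambda$ is real analytic on $U$. -/

import Mathlib

noncomputable section

namespace SplitGroup

/-- A Lie ring together with a norm on its underlying additive group. No compatibility between the
norm and the bracket is required. -/
class NormedLieRing (L : Type*) extends NormedAddCommGroup L, LieRing L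

/-- A real Lie algebra whose underlying real vector space is normed. In finite dimension all norms
are equivalent, so that the norm only serves to provide the usual topology and the usual notion of
a real analytic map; the bracket is automatically continuous. -/
class RealNormedLieAlgebra (L : Type*) [NormedLieRing L]
  extends NormedSpace ℝ L, LieAlgebra ℝ L

section

variable {L : Type*} [NormedLieRing L] [RealNormedLieAlgebra L] [FiniteDimensional ℝ L]

/-! ### Cartan involutions, split real forms, restricted roots -/

/-- A Cartan involution: an involutive automorphism `θ` of the real Lie algebra `L` such that the
form `-B(·, θ ·)` is positive definite, with `B` the Killing form. -/
structure IsCartanInvolution (θ : L ≃ₗ⁅ℝ⁆ L) : Prop where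
  involutive : ∀ X, θ (θ X) = X
  pos_def : ∀ X, X ≠ 0 → 0 < -(killingForm ℝ L X (θ X))

/-- The `+1` eigenspace of `θ`. -/
def kPart (θ : L ≃ₗ⁅ℝ⁆ L) : Submodule ℝ L :=
  Module.End.eigenspace (θ : L →ₗ[ℝ] L) 1

/-- The `-1` eigenspace of `θ`. -/
def pPart (θ : L ≃ₗ⁅ℝ⁆ L) : Submodule ℝ L :=
  Module.End.eigenspace (θ : L →ₗ[ℝ] L) (-1)

/-- `a` is maximal among the abelian subalgebras of `L` that are contained in `p`. (A linear
subspace on which the bracket vanishes is the same thing as an abelian subalgebra.) -/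
def IsMaximalAbelianIn (p a : Submodule ℝ L) : Prop :=
  Maximal (fun b : Submodule ℝ L => b ≤ p ∧ ∀ X ∈ b, ∀ Y ∈ b, ⁅X, Y⁆ = 0) a

variable (L) in
/-- `L` is a split real form of a complex simple Lie algebra: its complexification is simple, and
maximal abelian subspaces of the `-1` eigenspace of a Cartan involution are their own
centralizers in `L` (that is, they are Cartan subalgebras of `L`). -/
structure IsSplitRealForm : Prop where
  simple : LieAlgebra.IsSimple ℂ (TensorProduct ℝ ℂ L)
  split : ∀ (θ : L ≃ₗ⁅ℝ⁆ L) (a : Submodule ℝ L),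
    IsCartanInvolution θ → IsMaximalAbelianIn (pPart θ) a →
      ∀ X : L, (∀ A ∈ a, ⁅A, X⁆ = 0) → X ∈ a

/-- The set of restricted roots of `L` with respect to `a`: the nonzero linear forms `β` on `a`
whose root space `{X | ∀ A ∈ a, ⁅A, X⁆ = β(A) X}` is nonzero. -/
def restrictedRoots (a : Submodule ℝ L) : Set (Module.Dual ℝ a) :=
  {β | β ≠ 0 ∧ ∃ X : L, X ≠ 0 ∧ ∀ A : a, ⁅(A : L), X⁆ = β A • X}

/-- A notion of positivity on a real vector space, that is, (the set of positive elements of) a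
total ordering compatible with the vector space structure. -/
structure IsPositivity {V : Type*} [AddCommGroup V] [Module ℝ V] (pos : V → Prop) : Prop where
  xor_neg : ∀ v, v ≠ 0 → Xor (pos v) (pos (-v))
  add : ∀ v w, pos v → pos w → pos (v + w)
  smul : ∀ (c : ℝ) (v : V), 0 < c → pos v → pos (c • v)

/-- The simple roots for a given ordering: the positive restricted roots that are not a sum of two
positive restricted roots. -/
def simpleRoots (a : Submodule ℝ L) (pos : Module.Dual ℝ a → Prop) : Set (Module.Dual ℝ a) :=
  {β | β ∈ restrictedRoots a ∧ pos β ∧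
    ¬ ∃ γ ∈ restrictedRoots a, ∃ δ ∈ restrictedRoots a, pos γ ∧ pos δ ∧ β = γ + δ}

/-- The open Weyl chamber `𝔞⁺`. -/
def openChamber (a : Submodule ℝ L) (pos : Module.Dual ℝ a → Prop) : Set a :=
  {A | ∀ β ∈ simpleRoots a pos, 0 < β A}

/-! ### The adjoint group -/

/-- `ad X`, as a continuous linear endomorphism of `L`. -/
def adL (X : L) : L →L[ℝ] L :=
  LinearMap.toContinuousLinearMap (LieAlgebra.ad ℝ L X)

theorem isUnit_exp_adL (X : L) : IsUnit (NormedSpace.exp (adL X)) := by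
  let _ : NormedAlgebra ℚ (L →L[ℝ] L) := NormedAlgebra.restrictScalars ℚ ℝ (L →L[ℝ] L)
  have _ : CompleteSpace L := FiniteDimensional.complete ℝ L
  exact NormedSpace.isUnit_exp (adL X)

/-- `exp (ad X) = ∑ (ad X)ⁿ / n!`, as an element of the general linear group of `L`. -/
def expAd (X : L) : (L →L[ℝ] L)ˣ :=
  (isUnit_exp_adL X).unit

variable (L) in
/-- The connected adjoint group `Int L` of `L`: the analytic subgroup of the general linear group of
`L` with Lie algebra `ad L ≅ L`, that is, the subgroup generated by all `exp (ad X)`. It carries the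
topology induced by the general linear group; for semisimple `L`, `Int L` is closed in the general
linear group (it is the identity component of the automorphism group of `L`), so this is the Lie
group topology. -/
def adjointGroup : Subgroup (L →L[ℝ] L)ˣ :=
  Subgroup.closure (Set.range expAd)

/-- The exponential map of the Lie group `Int L`, whose Lie algebra is identified with `L`. -/
def expG (X : L) : adjointGroup L :=
  ⟨expAd X, Subgroup.subset_closure ⟨X, rfl⟩⟩

/-- The analytic subgroup of `Int L` whose Lie algebra is the `+1` eigenspace of `θ`. -/
def kGroup (θ : L ≃ₗ⁅ℝ⁆ L) : Subgroup (adjointGroup L) :=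
  Subgroup.closure (expG '' (kPart θ : Set L))

/-- Real analyticity of a map from the Lie group `Int L` to a normed space on a subset `U`: near
each `x ∈ U` the map is analytic in the exponential chart `X ↦ x exp X` (these charts define the
analytic structure of `Int L`). -/
def RealAnalyticOn {V : Type*} [NormedAddCommGroup V] [NormedSpace ℝ V]
    (f : adjointGroup L → V) (U : Set (adjointGroup L)) : Prop :=
  ∀ x ∈ U, AnalyticAt ℝ (fun X : L => f (x * expG X)) 0

/-! ### Jordan projection and purely loxodromic elements -/

/-- The element `x` of `Int L` is unipotent. -/
def IsUnipotent (x : adjointGroup L) : Prop :=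
  IsNilpotent (((x : (L →L[ℝ] L)ˣ) : L →L[ℝ] L) - 1)

/-- `x = x_k x_h x_u` is the (complete, multiplicative) Jordan decomposition of `x`: the factors
commute, `x_k` is conjugate into the analytic subgroup of `𝔨`, `x_h` is conjugate into the
exponential of the closed Weyl chamber and `x_u` is unipotent. -/
structure IsJordanDecomposition (θ : L ≃ₗ⁅ℝ⁆ L) (a : Submodule ℝ L)
    (pos : Module.Dual ℝ a → Prop) (x x_k x_h x_u : adjointGroup L) : Prop where
  eq_mul : x = x_k * x_h * x_u
  comm_kh : Commute x_k x_h
  comm_ku : Commute x_k x_u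
  comm_hu : Commute x_h x_u
  elliptic : ∃ y ∈ kGroup θ, IsConj x_k y
  hyperbolic : ∃ A ∈ closure (openChamber a pos), IsConj x_h (expG (A : L))
  unipotent : IsUnipotent x_u

/-- `A` is a point of the closed Weyl chamber such that `exp A` is conjugate to the hyperbolic part
`x_h` of `x`. -/
def IsJordanProjection (θ : L ≃ₗ⁅ℝ⁆ L) (a : Submodule ℝ L) (pos : Module.Dual ℝ a → Prop)
    (x : adjointGroup L) (A : a) : Prop :=
  A ∈ closure (openChamber a pos) ∧
    ∃ x_k x_h x_u : adjointGroup L,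
      IsJordanDecomposition θ a pos x x_k x_h x_u ∧ IsConj (expG (A : L)) x_h

open Classical in
/-- The Jordan projection `λ : Int L → 𝔞`, with values in the closed Weyl chamber. -/
def jordanProjection (θ : L ≃ₗ⁅ℝ⁆ L) (a : Submodule ℝ L) (pos : Module.Dual ℝ a → Prop)
    (x : adjointGroup L) : a :=
  if h : ∃ A : a, IsJordanProjection θ a pos x A then h.choose else 0

/-- The set of purely loxodromic elements: those conjugate into `exp 𝔞⁺`. -/
def purelyLoxodromic (a : Submodule ℝ L) (pos : Module.Dual ℝ a → Prop) :
    Set (adjointGroup L) :=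
  {x | ∃ A ∈ openChamber a pos, IsConj x (expG (A : L))}

/-- The Jordan projection of a purely loxodromic element satisfies its defining property (the
elliptic and the unipotent parts are trivial). -/
theorem jordanProjection_spec (θ : L ≃ₗ⁅ℝ⁆ L) (a : Submodule ℝ L)
    (pos : Module.Dual ℝ a → Prop) (x : adjointGroup L) (hx : x ∈ purelyLoxodromic a pos) :
    IsJordanProjection θ a pos x (jordanProjection θ a pos x) := by
  have h : ∃ A : a, IsJordanProjection θ a pos x A := by
    obtain ⟨A, hA, hc⟩ := hx
    refine ⟨A, subset_closure hA, 1, x, 1, ⟨by simp, Commute.one_left _, Commute.one_left _,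
      Commute.one_right _, ⟨1, one_mem _, IsConj.refl _⟩, ⟨A, subset_closure hA, hc⟩, ?_⟩, hc.symm⟩
    simp [IsUnipotent]
  rw [jordanProjection, dif_pos h]
  exact h.choose_spec

end

end SplitGroup

end

noncomputable section

namespace SplitGroup

open NormedSpace Topology Filter

/-! ### Eigenbases and exponentials of operators -/

section

/-! Both claims follow from a local normal form. Let `A` lie in the open chamber. No root vanishes
at `A`, and in the split case `a` is its own centralizer, so `1 - exp (ad A)` is invertible on the
sum of the root spaces and zero on `a`. Thus conjugation moves `exp A` in all root directions, and
changing `A` inside `a` supplies the rest. The analytic inverse function theorem then makes every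
automorphism near `exp (ad A)` conjugate to `exp (ad (A + τ))`, with `τ` in `a` depending
analytically on it (`exists_analytic_conj`). Since the chamber is open, `A + τ` stays inside it. No
charts on the group are needed: the inverse function theorem is applied to all endomorphisms of `L`,
with an extra factor transversal to `ad L` that is trivial on automorphisms near the identity
because derivations are inner.

It remains to identify the Jordan projection with `A + τ`, whatever Jordan decomposition is used. By
`eq_of_jordan`, the hyperbolic part of an element conjugate to `exp A` is the element itself. As
`exp` is injective on real diagonalizable operators, any candidate `A'` in the closed chamber is
conjugate to `A`.

Finally, conjugate points of the closed chamber coincide (`eq_of_map_eq_of_mem_closure`). The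
determinant form attached to the top eigenspaces of `ad A` is a highest weight vector for the group
action, so no weight in its orbit exceeds its own. Hence for `H` in the closed chamber the trace of
`ad H` over the top eigenspaces of `ad A` is at least the corresponding sum for `A'`. By symmetry
the two agree; summing over eigenvalue levels, the Killing form pairs `A` and `A'` equally with `H`.
Taking `H = A` and `H = A'`, definiteness on `p` gives `A = A'`. -/

theorem repr_apply_of_eigenbasis {V κ : Type*} [AddCommGroup V] [Module ℝ V]
    (c : Module.Basis κ ℝ V) {T : V →ₗ[ℝ] V} {t : κ → ℝ} (hT : ∀ k, T (c k) = t k • c k)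
    (v : V) (k : κ) : c.repr (T v) k = t k * c.repr v k := by
  have : c.coord k ∘ₗ T = t k • c.coord k := by
    refine c.ext fun j => ?_
    by_cases hj : j = k
    · subst hj; simp [hT]
    · simp [hT, hj]
  simpa using LinearMap.congr_fun this v

theorem exists_eq_of_eigenbasis {V κ : Type*} [AddCommGroup V] [Module ℝ V]
    (c : Module.Basis κ ℝ V) {T : V →ₗ[ℝ] V} {t : κ → ℝ} (hT : ∀ k, T (c k) = t k • c k)
    {v : V} (hv : v ≠ 0) {s : ℝ} (hs : T v = s • v) : ∃ k, t k = s := by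
  obtain ⟨k, hk⟩ : ∃ k, c.repr v k ≠ 0 := by
    by_contra! h0
    exact hv (c.repr.map_eq_zero_iff.1 (Finsupp.ext h0))
  have := repr_apply_of_eigenbasis c hT v k
  rw [hs, map_smul, Finsupp.smul_apply, smul_eq_mul] at this
  exact ⟨k, (mul_right_cancel₀ hk this).symm⟩

section ExpOperator

variable {E : Type*} [NormedAddCommGroup E] [NormedSpace ℝ E] [CompleteSpace E]

theorem exp_mul_exp_neg_clm (T : E →L[ℝ] E) : exp T * exp (-T) = 1 := by
  let _ : NormedAlgebra ℚ (E →L[ℝ] E) := NormedAlgebra.restrictScalars ℚ ℝ _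
  rw [← exp_add_of_commute (Commute.refl T).neg_right, add_neg_cancel, exp_zero]

theorem hasSum_exp_clm_apply (T : E →L[ℝ] E) (v : E) :
    HasSum (fun n : ℕ => ((n.factorial : ℝ)⁻¹) • (T ^ n) v) (exp T v) := by
  simpa using (exp_series_hasSum_exp' (𝕂 := ℝ) T).mapL (ContinuousLinearMap.apply ℝ E v)

theorem exp_clm_apply_eigenvector {T : E →L[ℝ] E} {v : E} {s : ℝ} (h : T v = s • v) :
    exp T v = Real.exp s • v := by
  have hp : ∀ n : ℕ, (T ^ n) v = s ^ n • v := by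
    intro n
    induction n with
    | zero => simp
    | succ n ih => rw [pow_succ', mul_apply_eq_comp, ih, map_smul, h, smul_smul,
        pow_succ]
  have h1 := hasSum_exp_clm_apply T v
  have h2 : HasSum (fun n : ℕ => ((n.factorial : ℝ)⁻¹) • s ^ n) (Real.exp s) := by
    rw [Real.exp_eq_exp_ℝ]
    exact exp_series_hasSum_exp' (𝕂 := ℝ) s
  refine h1.unique ?_
  simpa [hp, smul_smul] using h2.smul_const v

theorem exp_clm_apply_mem {T : E →L[ℝ] E} {W : Submodule ℝ E} (hW : IsClosed (W : Set E))
    (hT : ∀ w ∈ W, T w ∈ W) {w : E} (hw : w ∈ W) : exp T w ∈ W := by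
  have hp : ∀ n : ℕ, (T ^ n) w ∈ W := by
    intro n
    induction n with
    | zero => simpa
    | succ n ih => rw [pow_succ']; exact hT _ ih
  refine hW.mem_of_tendsto (hasSum_exp_clm_apply T w) (Eventually.of_forall fun s => ?_)
  exact W.sum_mem fun n _ => W.smul_mem _ (hp n)

theorem exp_clm_conj (g : (E →L[ℝ] E)ˣ) (T : E →L[ℝ] E) :
    exp ((g : E →L[ℝ] E) * T * ↑g⁻¹) = g * exp T * ↑g⁻¹ := by
  let _ : NormedAlgebra ℚ (E →L[ℝ] E) := NormedAlgebra.restrictScalars ℚ ℝ _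
  exact exp_units_conj g T

theorem hasDerivAt_exp_smul_clm_apply (T : E →L[ℝ] E) (v : E) (t : ℝ) :
    HasDerivAt (fun t : ℝ => exp (t • T) v) (T (exp (t • T) v)) t := by
  have := (hasDerivAt_exp_smul_const' (𝕂 := ℝ) T t).clm_apply (hasDerivAt_const t v)
  simpa using this

/-- Two operators with a basis of eigenvectors each and with the same exponential are equal. -/
theorem eq_of_exp_eq_of_eigenbasis {S T : E →L[ℝ] E} {ι κ : Type*}
    (b : Module.Basis ι ℝ E) {s : ι → ℝ} (hS : ∀ i, S (b i) = s i • b i)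
    (c : Module.Basis κ ℝ E) {t : κ → ℝ} (hT : ∀ i, T (c i) = t i • c i)
    (h : exp S = exp T) : S = T := by
  refine ContinuousLinearMap.coe_injective (b.ext fun i => ?_)
  have hexp := repr_apply_of_eigenbasis c (T := (exp T : E →L[ℝ] E))
    (t := fun k => Real.exp (t k)) fun k => exp_clm_apply_eigenvector (hT k)
  refine c.repr.injective (Finsupp.ext fun k => ?_)
  have h1 := hexp (b i) k
  rw [ContinuousLinearMap.coe_coe, ← h, exp_clm_apply_eigenvector (hS i)] at h1
  rw [repr_apply_of_eigenbasis c (T := T) hT]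
  simp only [ContinuousLinearMap.coe_coe, hS, map_smul, Finsupp.smul_apply,
    smul_eq_mul] at h1 ⊢
  -- Where the coordinate is nonzero, the exponentials of the two eigenvalues agree, and the real
  -- exponential is injective.
  by_cases h0 : c.repr (b i) k = 0
  · simp [h0]
  · rw [Real.exp_injective (mul_right_cancel₀ h0 h1)]

end ExpOperator

/-! ### The adjoint group acts by automorphisms -/

section Automorphism

variable {L : Type*} [NormedLieRing L] [RealNormedLieAlgebra L]

/-- The continuous linear endomorphism `φ` preserves the Lie bracket. -/
def PreservesBracket (φ : L →L[ℝ] L) : Prop := ∀ x y, φ ⁅x, y⁆ = ⁅φ x, φ y⁆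

theorem PreservesBracket.one : PreservesBracket (1 : L →L[ℝ] L) := fun _ _ => rfl

theorem PreservesBracket.mul {φ ψ : L →L[ℝ] L} (h : PreservesBracket φ) (h' : PreservesBracket ψ) :
    PreservesBracket (φ * ψ) := fun x y => by
  simp only [mul_apply_eq_comp, h' x y, h (ψ x) (ψ y)]

theorem PreservesBracket.of_mul_eq_one {φ ψ : L →L[ℝ] L} (h : PreservesBracket φ)
    (h1 : φ * ψ = 1) (h2 : ψ * φ = 1) : PreservesBracket ψ := fun x y => by
  have e : ∀ z, φ (ψ z) = z := fun z => by
    simpa using congrArg (fun f : L →L[ℝ] L => f z) h1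
  have e' : ∀ z, ψ (φ z) = z := fun z => by
    simpa using congrArg (fun f : L →L[ℝ] L => f z) h2
  rw [← e' ⁅ψ x, ψ y⁆, h, e, e]

variable [FiniteDimensional ℝ L]

variable (L) in
/-- The Lie bracket of a finite-dimensional real Lie algebra as a continuous bilinear map. -/
def bracketL : L →L[ℝ] L →L[ℝ] L :=
  LinearMap.toContinuousLinearMap
    (LinearMap.toContinuousLinearMap.toLinearMap ∘ₗ (LieAlgebra.ad ℝ L : L →ₗ[ℝ] Module.End ℝ L))

@[simp] theorem bracketL_apply (x y : L) : bracketL L x y = ⁅x, y⁆ := rfl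

@[simp] theorem adL_apply (x y : L) : adL x y = ⁅x, y⁆ := rfl

variable (L) in
/-- The adjoint representation as a continuous linear map. -/
def adCLM : L →L[ℝ] L →L[ℝ] L := bracketL L

@[simp] theorem adCLM_apply (x : L) : adCLM L x = adL x := rfl

instance : CompleteSpace L := FiniteDimensional.complete ℝ L

/-- By the Leibniz rule, the bracket of the two flows, pulled back by the inverse flow, has zero
derivative in `t`; compare `t = 1` with `t = 0`. -/
theorem preservesBracket_exp_adL (X : L) : PreservesBracket (exp (adL X)) := by
  intro x y
  have key : ∀ t : ℝ, HasDerivAt (fun t : ℝ => exp ((-t) • adL X) ⁅exp (t • adL X) x,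
      exp (t • adL X) y⁆) 0 t := by
    intro t
    have hx := hasDerivAt_exp_smul_clm_apply (adL X) x t
    have hy := hasDerivAt_exp_smul_clm_apply (adL X) y t
    have hb := ((bracketL L).hasFDerivAt.comp_hasDerivAt t hx).clm_apply hy
    have he : HasDerivAt (fun t : ℝ => exp ((-t) • adL X))
        (-(exp ((-t) • adL X) * adL X)) t := by
      have := (hasDerivAt_exp_smul_const (𝕂 := ℝ) (adL X) (-t)).scomp t (hasDerivAt_neg t)
      simpa [Function.comp_def] using this
    have := he.clm_apply hb
    refine this.congr_deriv ?_
    simp only [Function.comp_apply, bracketL_apply, neg_apply,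
      mul_apply_eq_comp, adL_apply]
    rw [← leibniz_lie, neg_add_cancel]
  have hc : ∀ t, (fun t : ℝ => exp ((-t) • adL X) ⁅exp (t • adL X) x,
      exp (t • adL X) y⁆) t = ⁅x, y⁆ := by
    intro t
    have := is_const_of_deriv_eq_zero (fun t => (key t).differentiableAt)
      (fun t => (key t).deriv) t 0
    simpa using this
  have h1 := hc 1
  simp only [one_smul, neg_smul] at h1
  rw [← h1, ← mul_apply_eq_comp, exp_mul_exp_neg_clm]
  rfl

@[simp] theorem coe_expAd (X : L) : ((expAd X : (L →L[ℝ] L)ˣ) : L →L[ℝ] L) = exp (adL X) := rfl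

@[simp] theorem coe_expAd_inv (X : L) :
    (((expAd X)⁻¹ : (L →L[ℝ] L)ˣ) : L →L[ℝ] L) = exp (-adL X) := by
  rw [Units.inv_eq_of_mul_eq_one_right (exp_mul_exp_neg_clm (adL X))]

theorem adL_neg (X : L) : adL (-X) = -adL X := by
  ext; simp

theorem preservesBracket_of_mem {g : (L →L[ℝ] L)ˣ} (hg : g ∈ adjointGroup L) :
    PreservesBracket (g : L →L[ℝ] L) := by
  induction hg using Subgroup.closure_induction with
  | mem x hx => obtain ⟨X, rfl⟩ := hx; exact preservesBracket_exp_adL X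
  | one => exact .one
  | mul x y _ _ hx hy => exact hx.mul hy
  | inv x _ hx => exact hx.of_mul_eq_one (by simp) (by simp)

theorem adL_map {g : (L →L[ℝ] L)ˣ} (hg : PreservesBracket (g : L →L[ℝ] L)) (X : L) :
    adL ((g : L →L[ℝ] L) X) = g * adL X * ↑g⁻¹ := by
  ext y
  have : (g : L →L[ℝ] L) ((↑g⁻¹ : L →L[ℝ] L) y) = y := by
    exact congrArg (fun f : L →L[ℝ] L => f y) g.mul_inv
  simp [hg X, this]

theorem exp_adL_map {g : (L →L[ℝ] L)ˣ} (hg : PreservesBracket (g : L →L[ℝ] L)) (X : L) :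
    exp (adL ((g : L →L[ℝ] L) X)) = g * exp (adL X) * ↑g⁻¹ := by
  rw [adL_map hg, exp_clm_conj]

theorem expG_map (g : adjointGroup L) (X : L) :
    expG (((g : (L →L[ℝ] L)ˣ) : L →L[ℝ] L) X) = g * expG X * g⁻¹ :=
  Subtype.ext (Units.ext (exp_adL_map (preservesBracket_of_mem g.2) X))

end Automorphism

end

/-! ### Cartan involutions, weight bases and restricted roots -/

section

/-- Commuting operators that are symmetric for a positive definite form have a common eigenbasis. -/
theorem exists_joint_eigenbasis {V : Type*} [AddCommGroup V] [Module ℝ V] [FiniteDimensional ℝ V]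
    (B : LinearMap.BilinForm ℝ V) (hsymm : ∀ x y, B x y = B y x) (hpos : ∀ x, x ≠ 0 → 0 < B x x)
    {ι : Type*} (T : ι → Module.End ℝ V) (hT : ∀ i x y, B (T i x) y = B x (T i y))
    (hcomm : ∀ i j, Commute (T i) (T j)) :
    ∃ (b : Module.Basis (Fin (Module.finrank ℝ V)) ℝ V)
      (χ : Fin (Module.finrank ℝ V) → ι → ℝ), ∀ j i, T i (b j) = χ j i • b j := by
  let core : InnerProductSpace.Core ℝ V :=
    { inner := fun x y => B x y
      conj_inner_symm := fun x y => by simpa using hsymm y x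
      re_inner_nonneg := fun x => by
        rcases eq_or_ne x 0 with rfl | hx
        · simp
        · simpa using (hpos x hx).le
      add_left := fun x y z => by simp
      smul_left := fun x y r => by simp
      definite := fun x hx => by
        by_contra h
        exact (hpos x h).ne' hx }
  let _ : NormedAddCommGroup V := core.toNormedAddCommGroup
  let _ : InnerProductSpace ℝ V := InnerProductSpace.ofCore core.toCore
  have hspan := LinearMap.IsSymmetric.iSup_iInf_eq_top_of_commute (𝕜 := ℝ) (T := T)
    (fun i x y => hT i x y) (fun i j _ => hcomm i j)
  let S : Set V := {v | ∃ χ : ι → ℝ, ∀ i, T i v = χ i • v}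
  have hS : ⊤ ≤ Submodule.span ℝ S := by
    rw [← hspan, iSup_le_iff]
    intro χ v hv
    refine Submodule.subset_span ⟨χ, fun i => ?_⟩
    simp only [Submodule.mem_iInf, Module.End.mem_eigenspace_iff] at hv
    exact hv i
  let b := Module.Basis.ofSpan hS
  have hb : ∀ i, b i ∈ S := fun i => Module.Basis.ofSpan_subset hS ⟨i, rfl⟩
  let _ := FiniteDimensional.fintypeBasisIndex b
  let e := Fintype.equivFinOfCardEq (Module.finrank_eq_card_basis b).symm
  choose χ hχ using hb
  exact ⟨b.reindex e, fun j => χ (e.symm j), fun j i => by simpa using hχ (e.symm j) i⟩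

section

variable {L : Type*} [NormedLieRing L] [RealNormedLieAlgebra L]

/-- The bilinear form `-κ(·, θ ·)` with `κ` the Killing form. -/
def cartanForm (θ : L ≃ₗ⁅ℝ⁆ L) : LinearMap.BilinForm ℝ L :=
  -(killingForm ℝ L).compl₂ (θ : L →ₗ[ℝ] L)

@[simp] theorem cartanForm_apply (θ : L ≃ₗ⁅ℝ⁆ L) (x y : L) :
    cartanForm θ x y = -killingForm ℝ L x (θ y) := rfl

theorem killingForm_map (θ : L ≃ₗ⁅ℝ⁆ L) (x y : L) :
    killingForm ℝ L (θ x) (θ y) = killingForm ℝ L x y :=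
  LieAlgebra.killingForm_of_equiv_apply θ x y

theorem killingForm_comm (x y : L) : killingForm ℝ L x y = killingForm ℝ L y x :=
  LieModule.traceForm_comm ℝ L L x y

theorem killingForm_lie_left (A x y : L) :
    killingForm ℝ L ⁅A, x⁆ y = -killingForm ℝ L x ⁅A, y⁆ := by
  rw [← lie_skew, map_neg, LinearMap.neg_apply]
  exact congrArg Neg.neg (LieModule.traceForm_apply_lie_apply ℝ L L x A y)

theorem cartanForm_symm {θ : L ≃ₗ⁅ℝ⁆ L} (hθ : IsCartanInvolution θ) (x y : L) :
    cartanForm θ x y = cartanForm θ y x := by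
  rw [cartanForm_apply, cartanForm_apply, ← killingForm_map θ x, hθ.involutive, killingForm_comm]

theorem mem_pPart {θ : L ≃ₗ⁅ℝ⁆ L} {x : L} : x ∈ pPart θ ↔ θ x = -x := by
  rw [pPart, Module.End.mem_eigenspace_iff, neg_one_smul]; rfl

theorem mem_kPart {θ : L ≃ₗ⁅ℝ⁆ L} {x : L} : x ∈ kPart θ ↔ θ x = x := by
  rw [kPart, Module.End.mem_eigenspace_iff, one_smul]; rfl

theorem cartanForm_lie_of_mem_pPart {θ : L ≃ₗ⁅ℝ⁆ L} {A : L} (hA : A ∈ pPart θ) (x y : L) :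
    cartanForm θ ⁅A, x⁆ y = cartanForm θ x ⁅A, y⁆ := by
  rw [mem_pPart] at hA
  rw [cartanForm_apply, cartanForm_apply, killingForm_lie_left, LieEquiv.map_lie, hA, neg_lie,
    map_neg]

theorem cartanForm_lie_of_mem_kPart {θ : L ≃ₗ⁅ℝ⁆ L} {A : L} (hA : A ∈ kPart θ) (x y : L) :
    cartanForm θ ⁅A, x⁆ y = -cartanForm θ x ⁅A, y⁆ := by
  rw [mem_kPart] at hA
  simp [killingForm_lie_left, hA, LieEquiv.map_lie]

/-- Nondegeneracy of the Killing form is what later makes every derivation inner. -/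
theorem IsCartanInvolution.isKilling [FiniteDimensional ℝ L] {θ : L ≃ₗ⁅ℝ⁆ L} (hθ : IsCartanInvolution θ) :
    LieAlgebra.IsKilling ℝ L where
  killingCompl_top_eq_bot := by
    rw [LieSubmodule.eq_bot_iff]
    intro x hx
    by_contra h
    have := hθ.pos_def x h
    rw [LieIdeal.mem_killingCompl] at hx
    rw [killingForm_comm, hx _ (LieSubmodule.mem_top _)] at this
    simp at this

/-- A basis of `L` consisting of joint eigenvectors of `ad A`, `A ∈ a`, together with the
corresponding weights. -/
structure WeightBasis (a : Submodule ℝ L) (J : Type*) where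
  /-- the basis -/
  basis : Module.Basis J ℝ L
  /-- the weight of each basis vector -/
  weight : J → Module.Dual ℝ a
  lie_basis : ∀ (A : a) (j : J), ⁅(A : L), basis j⁆ = weight j A • basis j

/-- For `A ∈ a ⊆ p` the operators `ad A` are symmetric for the positive definite form `cartanForm
θ`, and they commute by the Jacobi identity. -/
theorem IsCartanInvolution.nonempty_weightBasis [FiniteDimensional ℝ L] {θ : L ≃ₗ⁅ℝ⁆ L} (hθ : IsCartanInvolution θ)
    {a : Submodule ℝ L} (hp : a ≤ pPart θ) (hab : ∀ X ∈ a, ∀ Y ∈ a, ⁅X, Y⁆ = 0) :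
    Nonempty (WeightBasis a (Fin (Module.finrank ℝ L))) := by
  obtain ⟨b, χ, h⟩ := exists_joint_eigenbasis (cartanForm θ) (cartanForm_symm hθ)
    (fun x hx => hθ.pos_def x hx) (fun A : a => LieAlgebra.ad ℝ L (A : L))
    (fun A x y => cartanForm_lie_of_mem_pPart (hp A.2) x y)
    (fun A A' => LinearMap.ext fun x => by
      have := leibniz_lie (A : L) (A' : L) x
      rw [hab _ A.2 _ A'.2, zero_lie, zero_add] at this
      simpa using this)
  refine ⟨⟨b, fun j => (b.coord j ∘ₗ (LieModule.toEnd ℝ L L : L →ₗ[ℝ] Module.End ℝ L).flip (b j))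
    ∘ₗ a.subtype, fun A j => ?_⟩⟩
  have := h j A
  rw [LieAlgebra.ad_apply] at this
  simp [this]

namespace WeightBasis

variable {a : Submodule ℝ L} {J : Type*} (e : WeightBasis a J)

theorem repr_lie (A : a) (x : L) (j : J) :
    e.basis.repr ⁅(A : L), x⁆ j = e.weight j A * e.basis.repr x j :=
  repr_apply_of_eigenbasis e.basis (T := LieAlgebra.ad ℝ L (A : L)) (e.lie_basis A) x j

theorem weight_mem_restrictedRoots {j : J} (hj : e.weight j ≠ 0) :
    e.weight j ∈ restrictedRoots a :=
  ⟨hj, e.basis j, e.basis.ne_zero j, fun A => e.lie_basis A j⟩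

theorem exists_weight_eq {β : Module.Dual ℝ a} (hβ : β ∈ restrictedRoots a) :
    ∃ j, e.weight j = β := by
  obtain ⟨-, X, hX, h⟩ := hβ
  obtain ⟨j, hj⟩ : ∃ j, e.basis.repr X j ≠ 0 := by
    by_contra! h0
    exact hX (e.basis.repr.map_eq_zero_iff.1 (Finsupp.ext h0))
  refine ⟨j, LinearMap.ext fun A => ?_⟩
  have := e.repr_lie A X j
  rw [h A, map_smul, Finsupp.smul_apply, smul_eq_mul] at this
  exact (mul_right_cancel₀ hj this).symm

theorem finite_restrictedRoots [Finite J] (e : WeightBasis a J) : (restrictedRoots a).Finite :=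
  (Set.finite_range e.weight).subset fun _ hβ => e.exists_weight_eq hβ

theorem killingForm_eq [Fintype J] (A H : a) :
    killingForm ℝ L (A : L) (H : L) = ∑ j, e.weight j A * e.weight j H := by
  classical
  rw [killingForm_apply_apply, LinearMap.trace_eq_matrix_trace ℝ e.basis, Matrix.trace]
  refine Finset.sum_congr rfl fun j _ => ?_
  simp [LinearMap.toMatrix_apply, e.lie_basis, mul_comm]

end WeightBasis

/-! ### Positivity -/

theorem IsPositivity.finite_wellFounded {V : Type*} [AddCommGroup V] [Module ℝ V] {pos : V → Prop}
    (hpos : IsPositivity pos) {S : Set V} (hS : S.Finite) :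
    WellFounded fun v w : S => (w : V) - v ≠ 0 ∧ pos ((w : V) - v) := by
  have := hS.to_subtype
  have : IsTrans S fun v w : S => (w : V) - v ≠ 0 ∧ pos ((w : V) - v) := by
    refine ⟨fun u v w huv hvw => ?_⟩
    have hp : pos ((w : V) - u) := by
      simpa using hpos.add _ _ hvw.2 huv.2
    refine ⟨fun h0 => ?_, hp⟩
    have hwu : (w : V) = u := sub_eq_zero.1 h0
    have h1 := hpos.xor_neg _ huv.1
    rw [hwu, ← neg_sub] at hvw
    rcases h1 with h1 | h1
    · exact h1.2 hvw.2
    · exact h1.2 huv.2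
  have : Std.Irrefl fun v w : S => (w : V) - v ≠ 0 ∧ pos ((w : V) - v) :=
    ⟨fun v h => h.1 (sub_self _)⟩
  exact Finite.wellFounded_of_trans_of_irrefl _

/-- An additive property of the simple roots holds for all positive roots. -/
theorem pos_root_induction {a : Submodule ℝ L} (hfin : (restrictedRoots a).Finite)
    {pos : Module.Dual ℝ a → Prop} (hpos : IsPositivity pos) {Q : Module.Dual ℝ a → Prop}
    (hsimple : ∀ β ∈ simpleRoots a pos, Q β) (hadd : ∀ γ δ, Q γ → Q δ → Q (γ + δ))
    {β : Module.Dual ℝ a} (hβ : β ∈ restrictedRoots a) (hp : pos β) : Q β := by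
  have key : ∀ β : restrictedRoots a, pos β → Q β := by
    intro β
    induction β using (hpos.finite_wellFounded hfin).induction with
    | _ β ih =>
      intro hp
      by_cases hs : (β : Module.Dual ℝ a) ∈ simpleRoots a pos
      · exact hsimple _ hs
      · have : ∃ γ ∈ restrictedRoots a, ∃ δ ∈ restrictedRoots a,
            pos γ ∧ pos δ ∧ (β : Module.Dual ℝ a) = γ + δ := by
          by_contra h
          exact hs ⟨β.2, hp, h⟩
        obtain ⟨γ, hγ, δ, hδ, hpγ, hpδ, h⟩ := this
        rw [h]
        -- Each summand is smaller than `β` for the ordering, the difference being the other,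
        -- positive, summand.
        refine hadd _ _ (ih ⟨γ, hγ⟩ ?_ hpγ) (ih ⟨δ, hδ⟩ ?_ hpδ)
        · simpa [h] using ⟨hδ.1, hpδ⟩
        · simpa [h] using ⟨hγ.1, hpγ⟩
  exact key ⟨β, hβ⟩ hp

theorem neg_mem_restrictedRoots {θ : L ≃ₗ⁅ℝ⁆ L} {a : Submodule ℝ L} (hp : a ≤ pPart θ)
    {β : Module.Dual ℝ a} (hβ : β ∈ restrictedRoots a) : -β ∈ restrictedRoots a := by
  obtain ⟨h0, X, hX, h⟩ := hβ
  refine ⟨neg_ne_zero.2 h0, θ X, by simpa using hX, fun A => ?_⟩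
  have := congrArg θ (h A)
  rw [LieEquiv.map_lie, mem_pPart.1 (hp A.2), map_smul, neg_lie] at this
  rw [LinearMap.neg_apply, neg_smul, ← this, neg_neg]

section Chamber

variable {a : Submodule ℝ L} {pos : Module.Dual ℝ a → Prop}

theorem isOpen_openChamber [FiniteDimensional ℝ L] (hfin : (restrictedRoots a).Finite) :
    IsOpen (openChamber a pos) := by
  have : openChamber a pos = ⋂ β ∈ simpleRoots a pos, {A : a | 0 < β A} := by
    ext A; simp [openChamber]
  rw [this]
  exact (hfin.subset fun β h => h.1).isOpen_biInter fun β _ =>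
    isOpen_lt continuous_const (LinearMap.continuous_of_finiteDimensional β)

theorem simpleRoot_nonneg_of_mem_closure [FiniteDimensional ℝ L] {A : a} (hA : A ∈ closure (openChamber a pos))
    {β : Module.Dual ℝ a} (hβ : β ∈ simpleRoots a pos) : 0 ≤ β A :=
  closure_minimal (t := {A : a | 0 ≤ β A}) (fun _ h => (h β hβ).le)
    (isClosed_le continuous_const (LinearMap.continuous_of_finiteDimensional β)) hA

theorem posRoot_nonneg_of_mem_closure [FiniteDimensional ℝ L] (hfin : (restrictedRoots a).Finite)
    (hpos : IsPositivity pos) {A : a} (hA : A ∈ closure (openChamber a pos))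
    {β : Module.Dual ℝ a} (hβ : β ∈ restrictedRoots a) (hp : pos β) : 0 ≤ β A :=
  pos_root_induction hfin hpos (Q := fun β => 0 ≤ β A)
    (fun _ h => simpleRoot_nonneg_of_mem_closure hA h) (fun _ _ => add_nonneg) hβ hp

theorem posRoot_pos_of_mem_openChamber (hfin : (restrictedRoots a).Finite)
    (hpos : IsPositivity pos) {A : a} (hA : A ∈ openChamber a pos)
    {β : Module.Dual ℝ a} (hβ : β ∈ restrictedRoots a) (hp : pos β) : 0 < β A :=
  pos_root_induction hfin hpos (Q := fun β => 0 < β A) (fun β h => hA β h)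
    (fun _ _ => add_pos) hβ hp

theorem root_ne_zero_of_mem_openChamber {θ : L ≃ₗ⁅ℝ⁆ L} (hle : a ≤ pPart θ)
    (hfin : (restrictedRoots a).Finite) (hpos : IsPositivity pos) {A : a}
    (hA : A ∈ openChamber a pos) {β : Module.Dual ℝ a} (hβ : β ∈ restrictedRoots a) :
    β A ≠ 0 := by
  rcases hpos.xor_neg β hβ.1 with h | h
  · exact (posRoot_pos_of_mem_openChamber hfin hpos hA hβ h.1).ne'
  · have := posRoot_pos_of_mem_openChamber hfin hpos hA (neg_mem_restrictedRoots hle hβ) h.1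
    rw [LinearMap.neg_apply] at this
    exact (neg_pos.1 this).ne

theorem root_nonpos_of_mem_closure [FiniteDimensional ℝ L] {θ : L ≃ₗ⁅ℝ⁆ L} (hle : a ≤ pPart θ)
    (hfin : (restrictedRoots a).Finite) (hpos : IsPositivity pos) {A : a}
    (hA : A ∈ closure (openChamber a pos)) {β : Module.Dual ℝ a} (hβ : β ∈ restrictedRoots a)
    (hn : ¬ pos β) : β A ≤ 0 := by
  rcases hpos.xor_neg β hβ.1 with h | h
  · exact absurd h.1 hn
  · have := posRoot_nonneg_of_mem_closure hfin hpos hA (neg_mem_restrictedRoots hle hβ) h.1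
    rw [LinearMap.neg_apply] at this
    exact neg_nonneg.1 this

end Chamber

end

end

/-! ### Multilinear forms and the derivation action -/

section

section Multilinear

variable {E : Type*} [NormedAddCommGroup E] [NormedSpace ℝ E]
variable {ι : Type*} [Fintype ι]

/-- Multilinear forms on `E` with arguments indexed by `ι`. -/
def MForm (E : Type*) [NormedAddCommGroup E] [NormedSpace ℝ E] (ι : Type*) [Fintype ι] : Type _ :=
  ContinuousMultilinearMap ℝ (fun _ : ι => E) ℝ

namespace MForm

instance : NormedAddCommGroup (MForm E ι) :=
  inferInstanceAs (NormedAddCommGroup (ContinuousMultilinearMap ℝ (fun _ : ι => E) ℝ))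

instance : NormedSpace ℝ (MForm E ι) :=
  inferInstanceAs (NormedSpace ℝ (ContinuousMultilinearMap ℝ (fun _ : ι => E) ℝ))

instance : FunLike (MForm E ι) (ι → E) ℝ :=
  inferInstanceAs (FunLike (ContinuousMultilinearMap ℝ (fun _ : ι => E) ℝ) (ι → E) ℝ)

/-- A multilinear form as a continuous multilinear map. -/
def toCMM (f : MForm E ι) : ContinuousMultilinearMap ℝ (fun _ : ι => E) ℝ := f

@[simp] theorem toCMM_apply (f : MForm E ι) (v : ι → E) : f.toCMM v = f v := rfl

@[ext] theorem ext {f g : MForm E ι} (h : ∀ v, f v = g v) : f = g := DFunLike.ext f g h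

@[simp] theorem add_apply (f g : MForm E ι) (v : ι → E) : (f + g) v = f v + g v := rfl
@[simp] theorem sub_apply (f g : MForm E ι) (v : ι → E) : (f - g) v = f v - g v := rfl
@[simp] theorem neg_apply (f : MForm E ι) (v : ι → E) : (-f) v = -f v := rfl
@[simp] theorem smul_apply (c : ℝ) (f : MForm E ι) (v : ι → E) : (c • f) v = c * f v := rfl
@[simp] theorem zero_apply (v : ι → E) : (0 : MForm E ι) v = 0 := rfl

theorem map_update_add [DecidableEq ι] (f : MForm E ι) (v : ι → E) (i : ι) (x y : E) :
    f (Function.update v i (x + y)) = f (Function.update v i x) + f (Function.update v i y) :=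
  f.toCMM.map_update_add v i x y

theorem map_update_sub [DecidableEq ι] (f : MForm E ι) (v : ι → E) (i : ι) (x y : E) :
    f (Function.update v i (x - y)) = f (Function.update v i x) - f (Function.update v i y) :=
  f.toCMM.map_update_sub v i x y

theorem map_update_smul [DecidableEq ι] (f : MForm E ι) (v : ι → E) (i : ι) (c : ℝ) (x : E) :
    f (Function.update v i (c • x)) = c * f (Function.update v i x) :=
  f.toCMM.map_update_smul v i c x

variable [FiniteDimensional ℝ E]

instance : FiniteDimensional ℝ (MForm E ι) :=
  FiniteDimensional.of_injective (V := MForm E ι) (V₂ := MultilinearMap ℝ (fun _ : ι => E) ℝ)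
    { toFun := fun f => f.toCMM.toMultilinearMap
      map_add' := fun _ _ => rfl
      map_smul' := fun _ _ => rfl } ContinuousMultilinearMap.toMultilinearMap_injective

/-- The determinant form `v ↦ det (φ k (v i))` of a family of linear functionals. -/
def minor [DecidableEq ι] (φ : ι → Module.Dual ℝ E) : MForm E ι :=
  ({ Matrix.detRowAlternating.toMultilinearMap.compLinearMap (fun _ : ι => LinearMap.pi φ) with
    cont := Continuous.matrix_det (A := fun (v : ι → E) => Matrix.of fun i k => φ k (v i))
      (continuous_matrix fun i k =>
        (LinearMap.continuous_of_finiteDimensional (φ k)).comp (continuous_apply i)) } :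
    ContinuousMultilinearMap ℝ (fun _ : ι => E) ℝ)

theorem minor_apply [DecidableEq ι] (φ : ι → Module.Dual ℝ E) (v : ι → E) :
    minor φ v = (Matrix.of fun i k => φ k (v i)).det := rfl

end MForm

/-- The pullback of a multilinear form. -/
def pullback (g : E →L[ℝ] E) (f : MForm E ι) : MForm E ι :=
  f.toCMM.compContinuousLinearMap fun _ => g

@[simp] theorem pullback_apply (g : E →L[ℝ] E) (f : MForm E ι) (v : ι → E) :
    pullback g f v = f fun i => g (v i) := rfl

theorem pullback_pullback (g h : E →L[ℝ] E) (f : MForm E ι) :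
    pullback g (pullback h f) = pullback (h * g) f := rfl

theorem pullback_one (f : MForm E ι) : pullback 1 f = f := rfl

variable [DecidableEq ι] [FiniteDimensional ℝ E]

/-- The action of an endomorphism on multilinear forms by derivations. -/
def derivAction (D : E →L[ℝ] E) : MForm E ι →L[ℝ] MForm E ι :=
  LinearMap.toContinuousLinearMap
    { toFun := fun f => ((∑ i, f.toCMM.compContinuousLinearMap
        (Function.update (fun _ => ContinuousLinearMap.id ℝ E) i D) :
        ContinuousMultilinearMap ℝ (fun _ : ι => E) ℝ) : MForm E ι)
      map_add' := fun f g => by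
        refine MForm.ext fun v => ?_
        exact (congrArg (fun h : ContinuousMultilinearMap ℝ (fun _ : ι => E) ℝ => h v)
          (Finset.sum_add_distrib (s := Finset.univ)
            (f := fun i => f.toCMM.compContinuousLinearMap
              (Function.update (fun _ => ContinuousLinearMap.id ℝ E) i D))
            (g := fun i => g.toCMM.compContinuousLinearMap
              (Function.update (fun _ => ContinuousLinearMap.id ℝ E) i D))))
      map_smul' := fun c f => by
        refine MForm.ext fun v => ?_
        exact (congrArg (fun h : ContinuousMultilinearMap ℝ (fun _ : ι => E) ℝ => h v)
          (Finset.smul_sum (s := Finset.univ) (r := c)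
            (f := fun i => f.toCMM.compContinuousLinearMap
              (Function.update (fun _ => ContinuousLinearMap.id ℝ E) i D))).symm) }

@[simp] theorem derivAction_apply (D : E →L[ℝ] E) (f : MForm E ι) (v : ι → E) :
    derivAction D f v = ∑ i, f (Function.update v i (D (v i))) := by
  have : derivAction D f v = (∑ i, f.toCMM.compContinuousLinearMap
        (Function.update (fun _ => ContinuousLinearMap.id ℝ E) i D)) v := rfl
  rw [this, sum_apply]
  refine Finset.sum_congr rfl fun i _ => congrArg f (funext fun j => ?_)
  by_cases h : j = i
  · subst h; simp
  · simp [h]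

theorem derivAction_add (C D : E →L[ℝ] E) (f : MForm E ι) :
    derivAction (C + D) f = derivAction C f + derivAction D f := by
  ext v
  simp [MForm.map_update_add, Finset.sum_add_distrib]

theorem derivAction_smul (c : ℝ) (D : E →L[ℝ] E) (f : MForm E ι) :
    derivAction (c • D) f = c • derivAction D f := by
  ext v
  simp [MForm.map_update_smul, Finset.mul_sum]

/-- Terms acting on two different slots cancel in pairs. The commutator comes out reversed because
forms are contravariant. -/
theorem derivAction_comm (C D : E →L[ℝ] E) (f : MForm E ι) :
    derivAction C (derivAction D f) - derivAction D (derivAction C f) =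
      derivAction (D * C - C * D) f := by
  have expand : ∀ (C D : E →L[ℝ] E) (v : ι → E), derivAction C (derivAction D f) v =
      ∑ i, (f (Function.update v i (D (C (v i)))) + ∑ j ∈ Finset.univ.erase i,
        f (Function.update (Function.update v i (C (v i))) j (D (v j)))) := by
    intro C D v
    rw [derivAction_apply]
    refine Finset.sum_congr rfl fun i _ => ?_
    rw [derivAction_apply, ← Finset.add_sum_erase _ _ (Finset.mem_univ i)]
    congr 1
    · simp
    · refine Finset.sum_congr rfl fun j hj => ?_
      rw [Function.update_of_ne (Finset.ne_of_mem_erase hj)]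
  have swap : ∀ v : ι → E, ∑ i, ∑ j ∈ Finset.univ.erase i,
        f (Function.update (Function.update v i (C (v i))) j (D (v j))) =
      ∑ i, ∑ j ∈ Finset.univ.erase i,
        f (Function.update (Function.update v i (D (v i))) j (C (v j))) := by
    intro v
    rw [Finset.sum_comm' (t' := Finset.univ) (s' := fun j => Finset.univ.erase j)
      (by simp [eq_comm])]
    refine Finset.sum_congr rfl fun i _ => Finset.sum_congr rfl fun j hj => ?_
    rw [Function.update_comm (Finset.ne_of_mem_erase hj)]
  ext v
  rw [MForm.sub_apply, expand, expand, Finset.sum_add_distrib,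
    Finset.sum_add_distrib, swap, add_sub_add_right_eq_sub, ← Finset.sum_sub_distrib,
    derivAction_apply]
  refine Finset.sum_congr rfl fun i _ => ?_
  rw [← MForm.map_update_sub]
  rfl

theorem hasDerivAt_mform (c : ℝ → MForm E ι) (D : E →L[ℝ] E)
    (v : ι → E) (g : ℝ → E →L[ℝ] E) (t : ℝ) {c' : MForm E ι} (hc : HasDerivAt c c' t)
    (hg : ∀ v, HasDerivAt (fun t => g t v) (D (g t v)) t) :
    HasDerivAt (fun t => c t fun i => g t (v i))
      (c' (fun i => g t (v i)) + derivAction D (c t) fun i => g t (v i)) t := by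
  have hc' : HasDerivAt (fun t => (c t).toCMM) c'.toCMM t := hc
  have := (hc'.hasFDerivAt.continuousMultilinearMap_apply
    (fun i => (hg (v i)).hasFDerivAt)).hasDerivAt
  refine this.congr_deriv ?_
  rw [derivAction_apply]
  simp [ContinuousMultilinearMap.toContinuousLinearMap]

/-- The expression interpolating between the two sides, with time `1 - t` spent on the form and `t`
on its arguments, has zero derivative. -/
theorem exp_derivAction (D : E →L[ℝ] E) (f : MForm E ι) :
    exp (derivAction D) f = pullback (exp D) f := by
  have _ : CompleteSpace E := FiniteDimensional.complete ℝ E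
  have _ : CompleteSpace (MForm E ι) := FiniteDimensional.complete ℝ _
  ext v
  have key : ∀ t : ℝ, HasDerivAt (fun t : ℝ =>
      (exp ((1 - t) • derivAction D) f) fun i => exp (t • D) (v i)) 0 t := by
    intro t
    have hc : HasDerivAt (fun t : ℝ => exp ((1 - t) • derivAction (ι := ι) D) f)
        (-(derivAction D (exp ((1 - t) • derivAction D) f))) t := by
      have h1 : HasDerivAt (fun t : ℝ => 1 - t) (-1) t := by
        simpa using (hasDerivAt_id t).const_sub 1
      simpa [Function.comp_def] using
        (hasDerivAt_exp_smul_clm_apply (derivAction (ι := ι) D) f (1 - t)).scomp t h1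
    refine (hasDerivAt_mform _ D v _ t hc
      fun v => hasDerivAt_exp_smul_clm_apply D v t).congr_deriv ?_
    rw [MForm.neg_apply, neg_add_cancel]
  have := is_const_of_deriv_eq_zero (fun t => (key t).differentiableAt)
      (fun t => (key t).deriv) 0 1
  simpa using this

end Multilinear

end

/-! ### Determinant forms as highest weight vectors -/

section

section Minor

variable {E : Type*} [NormedAddCommGroup E] [NormedSpace ℝ E]
variable {J : Type*} (b : Module.Basis J ℝ E)
variable {ι : Type*}

/-- The common kernel of the coordinates in the image of `s`. -/
def coordKer (s : ι → J) : Submodule ℝ E := ⨅ k, LinearMap.ker (b.coord (s k))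

variable {b}

theorem mem_coordKer {s : ι → J} {v : E} : v ∈ coordKer b s ↔ ∀ k, b.repr v (s k) = 0 := by
  simp [coordKer]

variable [FiniteDimensional ℝ E] [Fintype ι] [DecidableEq ι]

variable (b) in
/-- The determinant form of the coordinates in the image of `s`. -/
def coordMinor (s : ι → J) : MForm E ι := MForm.minor fun k => b.coord (s k)

theorem coordMinor_basis {s : ι → J} (hs : Function.Injective s) :
    coordMinor b s (fun k => b (s k)) = 1 := by
  classical
  rw [coordMinor, MForm.minor_apply]
  convert Matrix.det_one (n := ι) (R := ℝ)
  ext i k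
  simp [Matrix.one_apply, Finsupp.single_apply, hs.eq_iff]

theorem coordMinor_ne_zero {s : ι → J} (hs : Function.Injective s) : coordMinor b s ≠ 0 := by
  intro h
  have := coordMinor_basis (b := b) hs
  rw [h] at this
  exact zero_ne_one this

/-- Each minor is a top-degree alternating form on the quotient by its `coordKer`, and `x` induces a
map of these quotients. The scalar is the determinant of that map. -/
theorem pullback_coordMinor {s s' : ι → J} (hs : Function.Injective s) {x : E →L[ℝ] E}
    (hx : ∀ v ∈ coordKer b s, x v ∈ coordKer b s') :
    ∃ c : ℝ, pullback x (coordMinor b s') = c • coordMinor b s := by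
  classical
  let N : Matrix ι ι ℝ := Matrix.of fun l k => b.repr (x (b (s l))) (s' k)
  have hN : ∀ v k, b.repr (x v) (s' k) = ∑ l, b.repr v (s l) * N l k := by
    intro v k
    have hv : v - ∑ l, b.repr v (s l) • b (s l) ∈ coordKer b s := by
      refine mem_coordKer.2 fun k => ?_
      simp [Finsupp.single_apply, hs.eq_iff]
    have := mem_coordKer.1 (hx _ hv) k
    simpa [sub_eq_zero, N] using this
  refine ⟨N.det, MForm.ext fun v => ?_⟩
  rw [pullback_apply, coordMinor, MForm.minor_apply, MForm.smul_apply, coordMinor,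
    MForm.minor_apply, mul_comm, ← Matrix.det_mul]
  congr 1
  ext i k
  simp [Matrix.mul_apply, hN]

theorem exists_perm_of_coordMinor_ne_zero {s q : ι → J}
    (h : coordMinor b s (fun k => b (q k)) ≠ 0) : ∃ σ : Equiv.Perm ι, ∀ k, q k = s (σ k) := by
  classical
  rw [coordMinor, MForm.minor_apply] at h
  have hmem : ∀ k, ∃ l, q k = s l := by
    intro k
    by_contra! hk
    refine h (Matrix.det_eq_zero_of_row_eq_zero k fun l => ?_)
    simp [Finsupp.single_eq_of_ne (hk l).symm]
  choose σ hσ using hmem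
  have hinj : Function.Injective σ := by
    intro i j hij
    by_contra hne
    refine h (Matrix.det_zero_of_row_eq hne ?_)
    ext l
    simp [hσ, hij]
  exact ⟨Equiv.ofBijective σ (Finite.injective_iff_bijective.1 hinj), hσ⟩

/-- Infinitesimal version of `pullback_coordMinor`: differentiate the scalars for `exp (t • D)` at
`t = 0`. They are differentiable because evaluation at the tuple where the minor is `1` recovers
them. -/
theorem derivAction_coordMinor {s : ι → J} (hs : Function.Injective s) {D : E →L[ℝ] E}
    (hD : ∀ v ∈ coordKer b s, D v ∈ coordKer b s) :
    ∃ c : ℝ, derivAction D (coordMinor b s) = c • coordMinor b s := by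
  have _ : CompleteSpace E := FiniteDimensional.complete ℝ E
  have hexp : ∀ t : ℝ, ∃ c : ℝ,
      pullback (exp (t • D)) (coordMinor b s) = c • coordMinor b s := fun t =>
    pullback_coordMinor hs fun v hv => exp_clm_apply_mem
      (Submodule.closed_of_finiteDimensional _) (fun w hw => Submodule.smul_mem _ t (hD w hw)) hv
  choose c hc using hexp
  have hderiv : ∀ v, HasDerivAt (fun t => c t * coordMinor b s v)
      (derivAction D (coordMinor b s) v) 0 := by
    intro v
    have := hasDerivAt_mform (fun _ => coordMinor b s) D v (fun t => exp (t • D)) 0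
      (hasDerivAt_const _ _) (fun v => hasDerivAt_exp_smul_clm_apply D v 0)
    refine (this.congr_deriv ?_).congr_of_eventuallyEq (Eventually.of_forall fun t => ?_)
    · simp
    · exact (congrArg (fun f : MForm E ι => f v) (hc t)).symm
  have h0 := hderiv fun k => b (s k)
  simp only [coordMinor_basis hs, mul_one] at h0
  exact ⟨_, MForm.ext fun v => (hderiv v).unique (h0.mul_const _)⟩

end Minor

section HighestWeight

variable {L : Type*} [NormedLieRing L] [RealNormedLieAlgebra L] [FiniteDimensional ℝ L]
variable {ι : Type*} [Fintype ι] [DecidableEq ι]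

theorem derivAction_adL_comm (X Y : L) (f : MForm L ι) :
    derivAction (adL X) (derivAction (adL Y) f) =
      derivAction (adL Y) (derivAction (adL X) f) + derivAction (adL ⁅Y, X⁆) f := by
  rw [← sub_eq_iff_eq_add', derivAction_comm]
  congr 2
  ext z
  simp

/-- A subspace of multilinear forms that is stable under the Lie algebra is stable under the
adjoint group. -/
theorem pullback_mem_of_derivAction_mem {W : Submodule ℝ (MForm L ι)}
    (hW : ∀ X : L, ∀ w ∈ W, derivAction (adL X) w ∈ W) {g : (L →L[ℝ] L)ˣ}
    (hg : g ∈ adjointGroup L) {w : MForm L ι} (hw : w ∈ W) :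
    pullback (g : L →L[ℝ] L) w ∈ W := by
  have _ : CompleteSpace (MForm L ι) := FiniteDimensional.complete ℝ _
  have hexp : ∀ X : L, ∀ w ∈ W, pullback (exp (adL X)) w ∈ W := fun X w hw => by
    rw [← exp_derivAction]
    exact exp_clm_apply_mem (Submodule.closed_of_finiteDimensional _) (hW X) hw
  -- Inverses are carried along so that the induction over the generated subgroup closes.
  suffices (∀ w ∈ W, pullback (g : L →L[ℝ] L) w ∈ W) ∧
      (∀ w ∈ W, pullback ((g⁻¹ : (L →L[ℝ] L)ˣ) : L →L[ℝ] L) w ∈ W) from this.1 w hw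
  clear hw w
  induction hg using Subgroup.closure_induction with
  | mem x hx =>
    obtain ⟨X, rfl⟩ := hx
    refine ⟨hexp X, fun w hw => ?_⟩
    rw [coe_expAd_inv, ← adL_neg]
    exact hexp _ w hw
  | one => exact ⟨fun w hw => hw, fun w hw => by rwa [inv_one]⟩
  | mul x y _ _ hx hy =>
    refine ⟨fun w hw => ?_, fun w hw => ?_⟩
    · rw [Units.val_mul, ← pullback_pullback]
      exact hy.1 _ (hx.1 _ hw)
    · rw [mul_inv_rev, Units.val_mul, ← pullback_pullback]
      exact hx.2 _ (hy.2 _ hw)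
  | inv x _ hx => exact ⟨hx.2, by simpa using hx.1⟩

variable {J : Type*} (b : Module.Basis J ℝ L) (p : J → Prop)

/-- The smallest subspace containing `f` and stable under the raising operators `b i` with
`p i`. -/
def raisingSpan (f : MForm L ι) : Submodule ℝ (MForm L ι) :=
  sInf {W | f ∈ W ∧ ∀ i, p i → ∀ w ∈ W, derivAction (adL (b i)) w ∈ W}

variable {b p}

theorem mem_raisingSpan_self (f : MForm L ι) : f ∈ raisingSpan b p f :=
  Submodule.mem_sInf.2 fun _ hW => hW.1

theorem raisingSpan_le {f : MForm L ι} {W : Submodule ℝ (MForm L ι)} (hf : f ∈ W)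
    (h : ∀ i, p i → ∀ w ∈ W, derivAction (adL (b i)) w ∈ W) : raisingSpan b p f ≤ W :=
  sInf_le ⟨hf, h⟩

theorem raising_mem_raisingSpan {f w : MForm L ι} {i : J} (hi : p i) (hw : w ∈ raisingSpan b p f) :
    derivAction (adL (b i)) w ∈ raisingSpan b p f :=
  Submodule.mem_sInf.2 fun W hW => hW.2 i hi _ (Submodule.mem_sInf.1 hw W hW)

/-- The multilinear forms without weights above `m`. -/
def weightLE (b : Module.Basis J ℝ L) (w : J → ℝ) (m : ℝ) : Submodule ℝ (MForm L ι) where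
  carrier := {f | ∀ q : ι → J, m < ∑ k, w (q k) → f (fun k => b (q k)) = 0}
  add_mem' h h' q hq := by rw [MForm.add_apply, h q hq, h' q hq, add_zero]
  zero_mem' _ _ := rfl
  smul_mem' c f h q hq := by rw [MForm.smul_apply, h q hq, mul_zero]

theorem coordMinor_mem_weightLE {w : J → ℝ} (s : ι → J) :
    coordMinor b s ∈ weightLE b w (∑ k, w (s k)) := by
  intro q hq
  by_contra h
  obtain ⟨σ, hσ⟩ := exists_perm_of_coordMinor_ne_zero h
  simp only [hσ] at hq
  rw [Equiv.sum_comp σ (fun k => w (s k))] at hq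
  exact hq.false

variable [Fintype J]

/-- If `f` spans a line stable under the other basis elements, the span under the raising
operators is stable under the whole Lie algebra. -/
theorem derivAction_mem_raisingSpan {f : MForm L ι}
    (hf : ∀ i, ¬ p i → ∃ c : ℝ, derivAction (adL (b i)) f = c • f) (X : L) {w : MForm L ι}
    (hw : w ∈ raisingSpan b p f) : derivAction (adL X) w ∈ raisingSpan b p f := by
  let S : Submodule ℝ (MForm L ι) :=
    { carrier := {w | w ∈ raisingSpan b p f ∧ ∀ X, derivAction (adL X) w ∈ raisingSpan b p f}
      add_mem' := fun h h' => ⟨add_mem h.1 h'.1, fun X => by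
        rw [map_add]; exact add_mem (h.2 X) (h'.2 X)⟩
      zero_mem' := ⟨zero_mem _, fun X => by rw [map_zero]; exact zero_mem _⟩
      smul_mem' := fun c w h => ⟨Submodule.smul_mem _ c h.1, fun X => by
        rw [map_smul]; exact Submodule.smul_mem _ c (h.2 X)⟩ }
  have hfS : f ∈ S := by
    refine ⟨mem_raisingSpan_self f, fun X => ?_⟩
    have : adL X = ∑ i, b.repr X i • adL (b i) := by
      have h := congrArg (adCLM L) (b.sum_repr X)
      rw [map_sum] at h
      simp only [map_smul] at h
      exact h.symm
    have hsum : derivAction (adL X) f = ∑ i, b.repr X i • derivAction (adL (b i)) f := by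
      let φ : (L →L[ℝ] L) →ₗ[ℝ] MForm L ι :=
        { toFun := fun D => derivAction D f
          map_add' := fun C D => derivAction_add C D f
          map_smul' := fun c D => derivAction_smul c D f }
      have := congrArg φ this
      rw [map_sum] at this
      simp only [map_smul] at this
      exact this
    rw [hsum]
    refine Submodule.sum_mem _ fun i _ => Submodule.smul_mem _ _ ?_
    by_cases hi : p i
    · exact raising_mem_raisingSpan hi (mem_raisingSpan_self f)
    · obtain ⟨c, hc⟩ := hf i hi
      rw [hc]
      exact Submodule.smul_mem _ _ (mem_raisingSpan_self f)
  -- Moving `X` past a raising operator costs only the action of a bracket. Since `S` quantifies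
  -- over all `X`, that term is controlled as well.
  refine (raisingSpan_le (W := S) hfS (fun i hi w hw => ⟨raising_mem_raisingSpan hi hw.1,
    fun X => ?_⟩) hw).2 X
  rw [derivAction_adL_comm]
  exact add_mem (raising_mem_raisingSpan hi (hw.2 X)) (hw.2 _)

/-- Bracketing an argument with `b i` raises the total weight of the tuple by `w i ≥ 0`, so a tuple
above `m` stays above `m`. -/
theorem derivAction_mem_weightLE {w : J → ℝ} {m : ℝ} {i : J} (hi : 0 ≤ w i)
    (hw : ∀ j k, b.repr ⁅b i, b j⁆ k ≠ 0 → w k = w i + w j) {f : MForm L ι}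
    (hf : f ∈ weightLE b w m) : derivAction (adL (b i)) f ∈ weightLE b w m := by
  intro q hq
  rw [derivAction_apply]
  refine Finset.sum_eq_zero fun k _ => ?_
  rw [adL_apply, ← b.sum_repr ⁅b i, b (q k)⁆]
  have hlin : ∀ x : L, f (Function.update (fun k => b (q k)) k x) =
      f.toCMM.toMultilinearMap.toLinearMap (fun k => b (q k)) k x := fun x => rfl
  rw [hlin, map_sum]
  refine Finset.sum_eq_zero fun j _ => ?_
  rw [map_smul, ← hlin]
  by_cases h : b.repr ⁅b i, b (q k)⁆ j = 0
  · rw [h, zero_smul]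
  · have hu : Function.update (fun k => b (q k)) k (b j) =
        fun l => b (Function.update q k j l) := by
      ext l
      by_cases hl : l = k
      · subst hl; simp
      · simp [hl]
    rw [hu, hf, smul_zero]
    refine hq.trans_le ?_
    have hj := hw _ _ h
    rw [← Finset.add_sum_erase _ _ (Finset.mem_univ k),
      ← Finset.add_sum_erase _ (fun l => w (Function.update q k j l)) (Finset.mem_univ k)]
    refine add_le_add ?_ (le_of_eq (Finset.sum_congr rfl fun l hl => ?_))
    · simp only [Function.update_self]; linarith
    · rw [Function.update_of_ne (Finset.ne_of_mem_erase hl)]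

/-- The extremal weight of the orbit of a highest weight form dominates all its weights. -/
theorem sum_weight_le_of_map_coordKer {w : J → ℝ} (hw : ∀ i, p i → 0 ≤ w i)
    (hadd : ∀ i j k, b.repr ⁅b i, b j⁆ k ≠ 0 → w k = w i + w j) {s s' : ι → J}
    (hs : Function.Injective s) (hs' : Function.Injective s')
    (hlow : ∀ i, ¬ p i → ∀ v ∈ coordKer b s, ⁅b i, v⁆ ∈ coordKer b s)
    {x : (L →L[ℝ] L)ˣ} (hx : x ∈ adjointGroup L)
    (hxs : ∀ v ∈ coordKer b s', (x : L →L[ℝ] L) v ∈ coordKer b s) :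
    ∑ k, w (s' k) ≤ ∑ k, w (s k) := by
  set f := coordMinor b s with hf
  have hstable : ∀ X : L, ∀ w ∈ raisingSpan b p f, derivAction (adL X) w ∈ raisingSpan b p f :=
    fun X w hw => derivAction_mem_raisingSpan
      (fun i hi => derivAction_coordMinor hs (hlow i hi)) X hw
  obtain ⟨c, hc⟩ := pullback_coordMinor hs' hxs
  have hc0 : c ≠ 0 := by
    rintro rfl
    have h1 : pullback ((x⁻¹ : (L →L[ℝ] L)ˣ) : L →L[ℝ] L) (pullback (x : L →L[ℝ] L) f) = f := by
      rw [pullback_pullback, Units.mul_inv, pullback_one]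
    rw [hf, hc, zero_smul, ← hf] at h1
    exact coordMinor_ne_zero hs h1.symm
  -- The pullback of `f` by `x` is a nonzero multiple of the minor of `s'`, which therefore lies in
  -- the group-stable span of `f`.
  have hmem : coordMinor b s' ∈ raisingSpan b p f := by
    have := pullback_mem_of_derivAction_mem hstable hx (mem_raisingSpan_self f)
    rw [hf, hc] at this
    exact (Submodule.smul_mem_iff _ hc0).1 this
  have hle := raisingSpan_le (W := weightLE b w (∑ k, w (s k))) (coordMinor_mem_weightLE s)
    (fun i hi f hf => derivAction_mem_weightLE (hw i hi) (hadd i) hf) hmem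
  by_contra! hlt
  have := hle s' hlt
  rw [coordMinor_basis hs'] at this
  exact one_ne_zero this

end HighestWeight

end

/-! ### Conjugate points of the closed chamber -/

section

variable {L : Type*} [NormedLieRing L] [RealNormedLieAlgebra L]

namespace WeightBasis

variable {a : Submodule ℝ L} {J : Type*} (e : WeightBasis a J)

theorem weight_add {i j k : J} (h : e.basis.repr ⁅e.basis i, e.basis j⁆ k ≠ 0) :
    e.weight k = e.weight i + e.weight j := by
  ext A
  have h1 := e.repr_lie A ⁅e.basis i, e.basis j⁆ k
  rw [leibniz_lie, e.lie_basis, e.lie_basis, smul_lie, lie_smul, ← add_smul, map_smul,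
    Finsupp.smul_apply, smul_eq_mul] at h1
  exact (mul_right_cancel₀ h h1).symm

/-- A root vector with nonpositive eigenvalue preserves the sum of the low eigenspaces. -/
theorem lie_mem_coordKer {P : ℝ → Prop} (hP : ∀ x y, x ≤ y → P x → P y) {A : a} {i : J}
    (hi : e.weight i A ≤ 0) {ι : Type*} {s : ι → J}
    (hs : ∀ j, (∃ k, s k = j) ↔ P (e.weight j A)) {v : L} (hv : v ∈ coordKer e.basis s) :
    ⁅e.basis i, v⁆ ∈ coordKer e.basis s := by
  refine mem_coordKer.2 fun k => ?_
  let φ : L →ₗ[ℝ] ℝ := e.basis.coord (s k) ∘ₗ LieAlgebra.ad ℝ L (e.basis i)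
  have hφ : φ v = ∑ j ∈ (e.basis.repr v).support, e.basis.repr v j • φ (e.basis j) := by
    conv_lhs => rw [← e.basis.linearCombination_repr v]
    simp [Finsupp.linearCombination_apply, Finsupp.sum]
  change φ v = 0
  rw [hφ]
  refine Finset.sum_eq_zero fun j hj => ?_
  by_contra h
  have hjk : e.weight (s k) = e.weight i + e.weight j :=
    e.weight_add fun h0 => (smul_ne_zero_iff.1 h).2 h0
  have hPj : P (e.weight j A) := by
    refine hP _ _ ?_ ((hs _).1 ⟨k, rfl⟩)
    rw [hjk, LinearMap.add_apply]
    linarith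
  obtain ⟨l, rfl⟩ := (hs j).2 hPj
  exact (smul_ne_zero_iff.1 h).1 (mem_coordKer.1 hv l)

/-- As `x` intertwines `ad A'` with `ad A`, it carries eigenvectors to eigenvectors with the same
eigenvalue. -/
theorem map_mem_coordKer {P : ℝ → Prop} {A A' : a} {ι ι' : Type*} {s : ι → J} {s' : ι' → J}
    (hs : ∀ j, (∃ k, s k = j) ↔ P (e.weight j A))
    (hs' : ∀ j, (∃ k, s' k = j) ↔ P (e.weight j A')) {x : L →L[ℝ] L} (hx : PreservesBracket x)
    (hA : x A' = A) {v : L} (hv : v ∈ coordKer e.basis s') : x v ∈ coordKer e.basis s := by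
  refine mem_coordKer.2 fun k => ?_
  let φ : L →ₗ[ℝ] ℝ := e.basis.coord (s k) ∘ₗ (x : L →ₗ[ℝ] L)
  have hφ : φ v = ∑ j ∈ (e.basis.repr v).support, e.basis.repr v j • φ (e.basis j) := by
    conv_lhs => rw [← e.basis.linearCombination_repr v]
    simp [Finsupp.linearCombination_apply, Finsupp.sum]
  change φ v = 0
  rw [hφ]
  refine Finset.sum_eq_zero fun j hj => ?_
  by_contra h
  have h1 := congrArg x (e.lie_basis A' j)
  rw [hx, hA, map_smul] at h1
  have h2 := e.repr_lie A (x (e.basis j)) (s k)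
  rw [h1, map_smul, Finsupp.smul_apply, smul_eq_mul] at h2
  have h3 := mul_right_cancel₀ (smul_ne_zero_iff.1 h).2 h2
  obtain ⟨l, rfl⟩ := (hs' j).2 (h3 ▸ (hs _).1 ⟨k, rfl⟩)
  exact (smul_ne_zero_iff.1 h).1 (mem_coordKer.1 hv l)

variable [Fintype J] [FiniteDimensional ℝ L]

theorem map_weight_eq_roots_charpoly (A : a) :
    Finset.univ.val.map (fun j => e.weight j A) = (LieAlgebra.ad ℝ L (A : L)).charpoly.roots := by
  classical
  have hdiag : LinearMap.toMatrix e.basis e.basis (LieAlgebra.ad ℝ L (A : L)) =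
      Matrix.diagonal fun j => e.weight j A := by
    ext i j
    rw [LinearMap.toMatrix_apply, LieAlgebra.ad_apply, e.lie_basis, Matrix.diagonal_apply]
    by_cases h : i = j
    · subst h; simp
    · simp [h]
  rw [← LinearMap.charpoly_toMatrix _ e.basis, hdiag, Matrix.charpoly_diagonal,
    Polynomial.roots_prod _ _ (by simp [Finset.prod_ne_zero_iff, Polynomial.X_sub_C_ne_zero])]
  simp

theorem map_weight_eq_of_map_eq {A A' : a} {g : (L →L[ℝ] L)ˣ}
    (hg : PreservesBracket (g : L →L[ℝ] L)) (h : (g : L →L[ℝ] L) A = A') :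
    Finset.univ.val.map (fun j => e.weight j A) = Finset.univ.val.map fun j => e.weight j A' := by
  rw [e.map_weight_eq_roots_charpoly, e.map_weight_eq_roots_charpoly]
  let E : L ≃ₗ[ℝ] L := (ContinuousLinearEquiv.ofUnit g).toLinearEquiv
  have : LieAlgebra.ad ℝ L (A' : L) = E.conj (LieAlgebra.ad ℝ L (A : L)) := by
    ext y
    have := congrArg (fun f : L →L[ℝ] L => f y) (adL_map hg A)
    rw [h] at this
    exact this
  rw [this, LinearEquiv.charpoly_conj]

/-- The minor of the top eigenspaces of `ad A` is a highest weight vector: root vectors that are not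
positive have eigenvalue at most `0` under `ad A`, so they preserve the low eigenspaces. The inverse
of `g` carries the low eigenspaces of `ad A'` to those of `ad A`, so `sum_weight_le_of_map_coordKer`
applies. -/
theorem sum_weight_filter_le {θ : L ≃ₗ⁅ℝ⁆ L} (hle : a ≤ pPart θ)
    {pos : Module.Dual ℝ a → Prop} (hpos : IsPositivity pos) {P : ℝ → Prop} [DecidablePred P]
    (hP : ∀ x y, x ≤ y → P x → P y) {A A' H : a} (hA : A ∈ closure (openChamber a pos))
    (hH : H ∈ closure (openChamber a pos)) {g : (L →L[ℝ] L)ˣ} (hg : g ∈ adjointGroup L)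
    (h : (g : L →L[ℝ] L) A = A') :
    ∑ j with P (e.weight j A'), e.weight j H ≤ ∑ j with P (e.weight j A), e.weight j H := by
  classical
  have hfin := e.finite_restrictedRoots
  have hcard : Fintype.card {j // P (e.weight j A)} = Fintype.card {j // P (e.weight j A')} := by
    have := congrArg (Multiset.countP P) (e.map_weight_eq_of_map_eq (preservesBracket_of_mem hg) h)
    rw [Multiset.countP_map, Multiset.countP_map] at this
    rw [Fintype.card_subtype, Fintype.card_subtype]
    exact this
  -- Both minors need a common index type. Conjugate operators have equally many eigenvalues in `P`.
  let σ := Fintype.equivOfCardEq hcard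
  let s : {j // P (e.weight j A)} → J := Subtype.val
  let s' : {j // P (e.weight j A)} → J := fun k => σ k
  have hs : ∀ j, (∃ k, s k = j) ↔ P (e.weight j A) := fun j =>
    ⟨by rintro ⟨k, rfl⟩; exact k.2, fun hj => ⟨⟨j, hj⟩, rfl⟩⟩
  have hs' : ∀ j, (∃ k, s' k = j) ↔ P (e.weight j A') := fun j =>
    ⟨by rintro ⟨k, rfl⟩; exact (σ k).2, fun hj => ⟨σ.symm ⟨j, hj⟩, by simp [s']⟩⟩
  have hginv : ((g⁻¹ : (L →L[ℝ] L)ˣ) : L →L[ℝ] L) A' = A := by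
    rw [← h]
    exact congrArg (fun f : L →L[ℝ] L => f A) g.inv_mul
  have key := sum_weight_le_of_map_coordKer (b := e.basis)
    (p := fun j => e.weight j ≠ 0 ∧ pos (e.weight j)) (w := fun j => e.weight j H)
    (fun i hi => posRoot_nonneg_of_mem_closure hfin hpos hH (e.weight_mem_restrictedRoots hi.1) hi.2)
    (fun i j k hk => by rw [e.weight_add hk, LinearMap.add_apply])
    (s := s) (s' := s') Subtype.val_injective (Subtype.val_injective.comp σ.injective)
    (fun i hi v hv => e.lie_mem_coordKer hP (by
      by_cases h0 : e.weight i = 0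
      · simp [h0]
      · exact root_nonpos_of_mem_closure hle hfin hpos hA (e.weight_mem_restrictedRoots h0)
          fun hp => hi ⟨h0, hp⟩) hs hv)
    (inv_mem hg)
    (fun v hv => e.map_mem_coordKer hs hs' (preservesBracket_of_mem (inv_mem hg)) hginv hv)
  have e1 : ∑ k, e.weight (s k) H = ∑ j with P (e.weight j A), e.weight j H :=
    (Finset.sum_subtype _ (by simp) fun j => e.weight j H).symm
  have e2 : ∑ k, e.weight (s' k) H = ∑ j with P (e.weight j A'), e.weight j H := by
    rw [Finset.sum_subtype _ (p := fun j => P (e.weight j A')) (by simp) fun j => e.weight j H]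
    exact Equiv.sum_comp σ fun k => e.weight k H
  rwa [e1, e2] at key

theorem sum_weight_mul_eq {θ : L ≃ₗ⁅ℝ⁆ L} (hle : a ≤ pPart θ)
    {pos : Module.Dual ℝ a → Prop} (hpos : IsPositivity pos) {A A' H : a}
    (hA : A ∈ closure (openChamber a pos)) (hA' : A' ∈ closure (openChamber a pos))
    (hH : H ∈ closure (openChamber a pos)) {g : (L →L[ℝ] L)ˣ} (hg : g ∈ adjointGroup L)
    (h : (g : L →L[ℝ] L) A = A') :
    ∑ j, e.weight j A * e.weight j H = ∑ j, e.weight j A' * e.weight j H := by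
  classical
  have hginv : ((g⁻¹ : (L →L[ℝ] L)ˣ) : L →L[ℝ] L) A' = A := by
    rw [← h]
    exact congrArg (fun f : L →L[ℝ] L => f A) g.inv_mul
  have hup : ∀ (P : ℝ → Prop) [DecidablePred P], (∀ x y, x ≤ y → P x → P y) →
      ∑ j with P (e.weight j A), e.weight j H = ∑ j with P (e.weight j A'), e.weight j H :=
    fun P _ hP => le_antisymm
      (e.sum_weight_filter_le hle hpos hP hA' hH (inv_mem hg) hginv)
      (e.sum_weight_filter_le hle hpos hP hA hH hg h)
  have hsplit : ∀ (B : a) (c : ℝ), ∑ j with c ≤ e.weight j B, e.weight j H =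
      ∑ j with c < e.weight j B, e.weight j H + ∑ j with e.weight j B = c, e.weight j H := by
    intro B c
    rw [← Finset.sum_union (Finset.disjoint_filter.2 fun j _ h1 h2 => h1.ne' h2)]
    refine Finset.sum_congr ?_ fun _ _ => rfl
    ext j
    simp [le_iff_lt_or_eq, eq_comm]
  -- Subtracting the cases `c ≤ x` and `c < x` isolates a single eigenvalue level.
  have hlevel : ∀ c : ℝ, ∑ j with e.weight j A = c, e.weight j H =
      ∑ j with e.weight j A' = c, e.weight j H := by
    intro c
    have h1 := hup (fun x => c ≤ x) fun x y hxy hx => hx.trans hxy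
    have h2 := hup (fun x => c < x) fun x y hxy hx => hx.trans_le hxy
    rw [hsplit, hsplit, h2] at h1
    exact add_left_cancel h1
  let T : Finset ℝ := Finset.univ.image (fun j => e.weight j A) ∪
    Finset.univ.image (fun j => e.weight j A')
  have hfiber : ∀ B : a, (∀ j, e.weight j B ∈ T) → ∑ j, e.weight j B * e.weight j H =
      ∑ c ∈ T, c * ∑ j with e.weight j B = c, e.weight j H := by
    intro B hB
    rw [← Finset.sum_fiberwise_of_maps_to (s := Finset.univ) (t := T) fun j _ => hB j]
    refine Finset.sum_congr rfl fun c _ => ?_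
    rw [Finset.mul_sum]
    exact Finset.sum_congr rfl fun j hj => by rw [(Finset.mem_filter.1 hj).2]
  rw [hfiber A (by simp [T]), hfiber A' (by simp [T])]
  exact Finset.sum_congr rfl fun c _ => by rw [hlevel]

end WeightBasis

/-- Two points of the closed Weyl chamber that are conjugate under the connected adjoint group are
equal. -/
theorem eq_of_map_eq_of_mem_closure [FiniteDimensional ℝ L] {θ : L ≃ₗ⁅ℝ⁆ L}
    (hθ : IsCartanInvolution θ) {a : Submodule ℝ L} (hle : a ≤ pPart θ)
    (hab : ∀ X ∈ a, ∀ Y ∈ a, ⁅X, Y⁆ = 0) {pos : Module.Dual ℝ a → Prop} (hpos : IsPositivity pos)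
    {A A' : a} (hA : A ∈ closure (openChamber a pos)) (hA' : A' ∈ closure (openChamber a pos))
    {g : (L →L[ℝ] L)ˣ} (hg : g ∈ adjointGroup L) (h : (g : L →L[ℝ] L) A = A') : A = A' := by
  obtain ⟨e⟩ := hθ.nonempty_weightBasis hle hab
  have key : ∀ H ∈ closure (openChamber a pos),
      killingForm ℝ L (A : L) (H : L) = killingForm ℝ L (A' : L) (H : L) := fun H hH => by
    rw [e.killingForm_eq, e.killingForm_eq]
    exact e.sum_weight_mul_eq hle hpos hA hA' hH hg h
  by_contra hne
  have hd : (A : L) - A' ≠ 0 := fun h0 => hne (Subtype.ext (sub_eq_zero.1 h0))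
  have hlt := hθ.pos_def _ hd
  rw [mem_pPart.1 (sub_mem (hle A.2) (hle A'.2)), map_neg, neg_neg, map_sub, map_sub,
    LinearMap.sub_apply, LinearMap.sub_apply, key A hA, key A' hA'] at hlt
  simp at hlt

end

/-! ### The hyperbolic part and uniqueness of the Jordan projection -/

section

/-- In a commuting product `X = K H U` of diagonalizable operators `X`, `H` with positive
eigenvalues, an isometry `K` of a definite quadratic function and a unipotent `U`, the factor `H`
equals `X`. -/
theorem eq_of_jordan {V : Type*} [AddCommGroup V] [Module ℝ V] [FiniteDimensional ℝ V]
    {X K H U : Module.End ℝ V} (hX : X = K * H * U) (hKH : Commute K H) (hKU : Commute K U)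
    (hHU : Commute H U) {ι κ : Type*} (b : Module.Basis ι ℝ V) {ν : ι → ℝ}
    (hb : ∀ i, X (b i) = ν i • b i) (hν : ∀ i, 0 < ν i) (c : Module.Basis κ ℝ V) {μ : κ → ℝ}
    (hc : ∀ i, H (c i) = μ i • c i) (hμ : ∀ i, 0 < μ i) {Q : V → ℝ} (hQ : ∀ v, v ≠ 0 → 0 < Q v)
    (hQsmul : ∀ (r : ℝ) v, Q (r • v) = r ^ 2 * Q v) (hQK : ∀ v, Q (K v) = Q v)
    (hU : IsNilpotent (U - 1)) : H = X := by
  have hXH : Commute H X := by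
    rw [hX]; exact (hKH.symm.mul_right (Commute.refl H)).mul_right hHU
  have hXU : Commute U X := by
    rw [hX]; exact (hKU.symm.mul_right hHU.symm).mul_right (Commute.refl U)
  have hcomm : ∀ {S T : Module.End ℝ V}, Commute S T → ∀ (r : ℝ) (v : V), T v = r • v →
      T (S v) = r • S v := fun {S T} h r v hv => by
    rw [← Module.End.mul_apply, ← h.eq, Module.End.mul_apply, hv, map_smul]
  have heig : ∀ (r s : ℝ) (v : V), v ≠ 0 → X v = r • v → H v = s • v → r = s := by
    intro r s v hv hXv hHv
    obtain ⟨i, rfl⟩ := exists_eq_of_eigenbasis b hb hv hXv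
    obtain ⟨k, rfl⟩ := exists_eq_of_eigenbasis c hc hv hHv
    have hpow : ∀ n : ℕ, X (((U - 1) ^ n : Module.End ℝ V) v) = ν i • ((U - 1) ^ n : Module.End ℝ V) v ∧
        H (((U - 1) ^ n : Module.End ℝ V) v) = μ k • ((U - 1) ^ n : Module.End ℝ V) v := fun n =>
      ⟨hcomm ((hXU.sub_left (Commute.one_left X)).pow_left n) _ _ hXv,
        hcomm ((hHU.symm.sub_left (Commute.one_left H)).pow_left n) _ _ hHv⟩
    -- The last nonzero `(U - 1) ^ n v` is fixed by `U` and remains a joint eigenvector of `X` and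
    -- `H`. On it `X` acts as `K * H`, and comparing values of `Q` gives equal squares of positive
    -- eigenvalues.
    obtain ⟨w, hw0, hUw, hXw, hHw⟩ : ∃ w, w ≠ 0 ∧ U w = w ∧ X w = ν i • w ∧ H w = μ k • w := by
      classical
      have hex : ∃ n : ℕ, ((U - 1) ^ n : Module.End ℝ V) v = 0 := by
        obtain ⟨n, hn⟩ := hU
        exact ⟨n, by rw [hn]; rfl⟩
      obtain ⟨n, hn⟩ : ∃ n, Nat.find hex = n + 1 := by
        refine Nat.exists_eq_succ_of_ne_zero fun h0 => hv ?_
        simpa [h0] using Nat.find_spec hex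
      refine ⟨((U - 1) ^ n : Module.End ℝ V) v, Nat.find_min hex (by omega), ?_, hpow n⟩
      have := Nat.find_spec hex
      rw [hn, pow_succ', Module.End.mul_apply, LinearMap.sub_apply, sub_eq_zero] at this
      exact this
    have hKw : μ k • K w = ν i • w := by
      rw [← hXw, hX, Module.End.mul_apply, Module.End.mul_apply, hUw, hHw, map_smul]
    have hsq := congrArg Q hKw
    rw [hQsmul, hQsmul, hQK] at hsq
    exact ((sq_eq_sq₀ (hμ k).le (hν i).le).1 (mul_right_cancel₀ (hQ w hw0).ne' hsq)).symm
  refine b.ext fun i => ?_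
  have htop : ⨆ s : ℝ, H.genEigenspace s 1 = ⊤ := by
    rw [eq_top_iff, ← c.span_eq, Submodule.span_le]
    rintro _ ⟨k, rfl⟩
    exact Submodule.mem_iSup_of_mem (μ k) (Module.End.mem_eigenspace_iff.2 (hc k))
  -- Each eigenspace of `X` is `H`-stable, hence splits into eigenspaces of the diagonalizable `H`.
  have hmem := Submodule.inf_iSup_genEigenspace (p := Module.End.eigenspace X (ν i)) (f := H)
    (fun v hv => Module.End.mem_eigenspace_iff.2
      (hcomm hXH _ _ (Module.End.mem_eigenspace_iff.1 hv))) 1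
  rw [htop, inf_top_eq] at hmem
  have hle : Module.End.eigenspace X (ν i) ≤ LinearMap.ker (H - X) := by
    rw [hmem, iSup_le_iff]
    rintro s v ⟨hv1, hv2⟩
    have h1 := Module.End.mem_eigenspace_iff.1 hv1
    have h2 := Module.End.mem_eigenspace_iff.1 hv2
    rcases eq_or_ne v 0 with rfl | hv
    · exact zero_mem _
    · rw [LinearMap.mem_ker, LinearMap.sub_apply, h1, h2, heig _ _ v hv h1 h2, sub_self]
  exact sub_eq_zero.1 (LinearMap.mem_ker.1 (hle (Module.End.mem_eigenspace_iff.2 (hb i))))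

variable {L : Type*} [NormedLieRing L] [RealNormedLieAlgebra L] [FiniteDimensional ℝ L]

/-- For `X` in `k`, `ad X` is skew for the form, so its flow preserves it. -/
theorem cartanForm_exp_adL {θ : L ≃ₗ⁅ℝ⁆ L} {X : L} (hX : X ∈ kPart θ) (v : L) :
    cartanForm θ (exp (adL X) v) (exp (adL X) v) = cartanForm θ v v := by
  let B : L →L[ℝ] L →L[ℝ] ℝ := LinearMap.toContinuousLinearMap
    (LinearMap.toContinuousLinearMap.toLinearMap ∘ₗ cartanForm θ)
  have key : ∀ t : ℝ, HasDerivAt (fun t : ℝ => B (exp (t • adL X) v) (exp (t • adL X) v)) 0 t := by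
    intro t
    have h := hasDerivAt_exp_smul_clm_apply (adL X) v t
    refine ((B.hasFDerivAt.comp_hasDerivAt t h).clm_apply h).congr_deriv ?_
    change cartanForm θ ⁅X, _⁆ _ + cartanForm θ _ ⁅X, _⁆ = 0
    rw [cartanForm_lie_of_mem_kPart hX, neg_add_cancel]
  have := is_const_of_deriv_eq_zero (fun t => (key t).differentiableAt)
      (fun t => (key t).deriv) 1 0
  simp only [one_smul, zero_smul, exp_zero] at this
  exact this

theorem cartanForm_of_mem_kGroup {θ : L ≃ₗ⁅ℝ⁆ L} {y : adjointGroup L} (hy : y ∈ kGroup θ) (v : L) :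
    cartanForm θ (((y : (L →L[ℝ] L)ˣ) : L →L[ℝ] L) v) (((y : (L →L[ℝ] L)ˣ) : L →L[ℝ] L) v) =
      cartanForm θ v v := by
  induction hy using Subgroup.closure_induction generalizing v with
  | mem x hx =>
    obtain ⟨X, hX, rfl⟩ := hx
    exact cartanForm_exp_adL hX v
  | one => rfl
  | mul x y _ _ hx hy => exact (hx _).trans (hy v)
  | inv x _ hx =>
    rw [← hx]
    have : (((x : (L →L[ℝ] L)ˣ) : L →L[ℝ] L)
        ((((x⁻¹ : adjointGroup L) : (L →L[ℝ] L)ˣ) : L →L[ℝ] L) v)) = v :=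
      congrArg (fun f : L →L[ℝ] L => f v) (x : (L →L[ℝ] L)ˣ).mul_inv
    rw [this]

theorem WeightBasis.exists_eigenbasis_map {a : Submodule ℝ L} {J : Type*} (e : WeightBasis a J)
    (g : adjointGroup L) (A : a) : ∃ b : Module.Basis J ℝ L,
      ∀ j, adL (((g : (L →L[ℝ] L)ˣ) : L →L[ℝ] L) A) (b j) = e.weight j A • b j := by
  refine ⟨e.basis.map (ContinuousLinearEquiv.ofUnit (g : (L →L[ℝ] L)ˣ)).toLinearEquiv,
    fun j => ?_⟩
  have : ∀ v, (ContinuousLinearEquiv.ofUnit (g : (L →L[ℝ] L)ˣ)).toLinearEquiv v =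
      ((g : (L →L[ℝ] L)ˣ) : L →L[ℝ] L) v := fun v => rfl
  rw [Module.Basis.map_apply, this, adL_apply, ← preservesBracket_of_mem g.2, e.lie_basis,
    map_smul]

theorem IsCartanInvolution.adL_injective {θ : L ≃ₗ⁅ℝ⁆ L} (hθ : IsCartanInvolution θ) :
    Function.Injective (adL : L → L →L[ℝ] L) := by
  intro X Y h
  by_contra hne
  have h0 : LieAlgebra.ad ℝ L (X - Y) = 0 := by
    ext v
    have := congrArg (fun f : L →L[ℝ] L => f v) h
    simpa [sub_eq_zero] using this
  have := hθ.pos_def (X - Y) (sub_ne_zero.2 hne)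
  rw [killingForm_apply_apply, h0] at this
  simp at this

/-- The Jordan projection of an element conjugate to `exp A`, with `A` in the closed Weyl chamber,
is `A`. -/
theorem IsJordanProjection.eq_of_isConj {θ : L ≃ₗ⁅ℝ⁆ L} (hθ : IsCartanInvolution θ)
    {a : Submodule ℝ L} (hle : a ≤ pPart θ) (hab : ∀ X ∈ a, ∀ Y ∈ a, ⁅X, Y⁆ = 0)
    {pos : Module.Dual ℝ a → Prop} (hpos : IsPositivity pos) {x : adjointGroup L} {A A' : a}
    (hA : A ∈ closure (openChamber a pos)) (hx : IsConj x (expG (A : L)))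
    (h : IsJordanProjection θ a pos x A') : A' = A := by
  obtain ⟨hA', x_k, x_h, x_u, hd, hconj⟩ := h
  obtain ⟨e⟩ := hθ.nonempty_weightBasis hle hab
  obtain ⟨g, hg⟩ := isConj_iff.1 hx.symm
  obtain ⟨g', hg'⟩ := isConj_iff.1 hconj
  rw [← expG_map] at hg hg'
  obtain ⟨y, hy, hky⟩ := hd.elliptic
  obtain ⟨z, hz⟩ := isConj_iff.1 hky
  obtain ⟨b, hb⟩ := e.exists_eigenbasis_map g A
  obtain ⟨c, hc⟩ := e.exists_eigenbasis_map g' A'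
  let op : adjointGroup L →* Module.End ℝ L :=
    { toFun := fun g => (((g : (L →L[ℝ] L)ˣ) : L →L[ℝ] L) : L →ₗ[ℝ] L)
      map_one' := rfl
      map_mul' := fun _ _ => rfl }
  have hopx : ∀ (Y : L), op (expG Y) = (exp (adL Y) : L →L[ℝ] L) := fun _ => rfl
  -- The quadratic function is the Cartan form transported by `z`, which conjugates the elliptic
  -- part into `kGroup θ`.
  have hop : op x_h = op x := by
    refine eq_of_jordan (K := op x_k) (U := op x_u) (by rw [hd.eq_mul, map_mul, map_mul])
      (hd.comm_kh.map op) (hd.comm_ku.map op) (hd.comm_hu.map op) b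
      (ν := fun j => Real.exp (e.weight j A)) (fun j => ?_) (fun j => Real.exp_pos _) c
      (μ := fun j => Real.exp (e.weight j A')) (fun j => ?_) (fun j => Real.exp_pos _)
      (Q := fun v => cartanForm θ (op z v) (op z v)) (fun v hv => ?_) (fun r v => ?_)
      (fun v => ?_) ?_
    · rw [← hg]
      exact exp_clm_apply_eigenvector (hb j)
    · rw [← hg']
      exact exp_clm_apply_eigenvector (hc j)
    · refine hθ.pos_def _ fun h0 => hv ?_
      have : op z⁻¹ (op z v) = v := by
        rw [← Module.End.mul_apply, ← map_mul, inv_mul_cancel, map_one, Module.End.one_apply]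
      rw [← this, h0, map_zero]
    · simp only [map_smul, LinearMap.smul_apply, smul_eq_mul]
      ring
    · have h1 : op z (op x_k v) = op y (op z v) := by
        rw [← Module.End.mul_apply, ← Module.End.mul_apply, ← map_mul, ← map_mul, ← hz]
        congr 2
        group
      simp only [h1]
      exact cartanForm_of_mem_kGroup hy (op z v)
    · obtain ⟨n, hn⟩ := hd.unipotent
      refine ⟨n, ?_⟩
      have := congrArg (ContinuousLinearMap.toLinearMapRingHom (R₁ := ℝ) (M₁ := L)) hn
      rw [map_pow, map_zero] at this
      exact this
  rw [← hg, ← hg'] at hop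
  have hexp : exp (adL (((g' : (L →L[ℝ] L)ˣ) : L →L[ℝ] L) A')) =
      exp (adL (((g : (L →L[ℝ] L)ˣ) : L →L[ℝ] L) A)) := ContinuousLinearMap.coe_injective hop
  have hAA := hθ.adL_injective (eq_of_exp_eq_of_eigenbasis c hc b hb hexp)
  refine eq_of_map_eq_of_mem_closure hθ hle hab hpos hA' hA
    (g := ((g⁻¹ * g' : adjointGroup L) : (L →L[ℝ] L)ˣ)) (SetLike.coe_mem _) ?_
  have : ((((g⁻¹ * g' : adjointGroup L) : (L →L[ℝ] L)ˣ)) : L →L[ℝ] L) A' =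
      (((g : (L →L[ℝ] L)ˣ)⁻¹ : (L →L[ℝ] L)ˣ) : L →L[ℝ] L)
        (((g' : (L →L[ℝ] L)ˣ) : L →L[ℝ] L) A') := rfl
  rw [this, hAA]
  exact congrArg (fun f : L →L[ℝ] L => f A) (g : (L →L[ℝ] L)ˣ).inv_mul

end

/-! ### Local normal form near a regular element -/

section

variable {L : Type*} [NormedLieRing L] [RealNormedLieAlgebra L] [FiniteDimensional ℝ L]

variable (L) in
/-- The coboundary `Z ↦ ((x, y) ↦ Z ⁅x, y⁆ - ⁅Z x, y⁆ - ⁅x, Z y⁆)`, whose kernel consists of the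
derivations. -/
def derivDefect : (L →L[ℝ] L) →ₗ[ℝ] (L →L[ℝ] L →L[ℝ] L) where
  toFun Z := (ContinuousLinearMap.compL ℝ L L L Z).comp (bracketL L) - (bracketL L).comp Z -
    ((bracketL L).flip.comp Z).flip
  map_add' Z W := by ext; simp; abel
  map_smul' c Z := by ext; simp [smul_sub]

@[simp] theorem derivDefect_apply (Z : L →L[ℝ] L) (x y : L) :
    derivDefect L Z x y = Z ⁅x, y⁆ - ⁅Z x, y⁆ - ⁅x, Z y⁆ := rfl

theorem exists_adL_eq_of_derivDefect_eq_zero [LieAlgebra.IsKilling ℝ L] {Z : L →L[ℝ] L}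
    (hZ : derivDefect L Z = 0) : ∃ X : L, adL X = Z := by
  let D : LieDerivation ℝ L L :=
    { toLinearMap := Z
      leibniz' := fun x y => by
        have := congrArg (fun f : L →L[ℝ] L →L[ℝ] L => f x y) hZ
        simp only [derivDefect_apply, zero_apply] at this
        rw [sub_sub, sub_eq_zero] at this
        rw [ContinuousLinearMap.coe_coe, this, ← lie_skew (Z x) y]
        abel }
  obtain ⟨X, hX⟩ := LieDerivation.IsKilling.exists_eq_ad D
  refine ⟨X, ContinuousLinearMap.ext fun y => ?_⟩
  have := congrArg (fun f : LieDerivation ℝ L L => f y) hX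
  simpa [D] using this

theorem exists_norm_le_of_injOn {E F : Type*} [NormedAddCommGroup E] [NormedSpace ℝ E]
    [FiniteDimensional ℝ E] [NormedAddCommGroup F] [NormedSpace ℝ F] (δ : E →ₗ[ℝ] F)
    (N : Submodule ℝ E) (h : ∀ z ∈ N, δ z = 0 → z = 0) :
    ∃ K : ℝ, 0 < K ∧ ∀ z ∈ N, ‖z‖ ≤ K * ‖δ z‖ := by
  have hker : LinearMap.ker (δ.domRestrict N) = ⊥ :=
    LinearMap.ker_eq_bot'.2 fun z hz => Subtype.ext (h z z.2 hz)
  obtain ⟨K, hK, hanti⟩ := LinearMap.exists_antilipschitzWith _ hker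
  refine ⟨K, hK, fun z hz => ?_⟩
  simpa [dist_zero_right] using hanti.le_mul_dist (⟨z, hz⟩ : N) 0

/-- Automorphisms close to the identity are determined by their inner component. -/
theorem exists_norm_lt_eq_zero_of_preservesBracket [LieAlgebra.IsKilling ℝ L]
    {P : (L →L[ℝ] L) →ₗ[ℝ] L} (hP : ∀ X, P (adL X) = X) :
    ∃ ε > 0, ∀ Z : L →L[ℝ] L, P Z = 0 → ‖Z‖ < ε → PreservesBracket (1 + Z) → Z = 0 := by
  obtain ⟨K, hK, hanti⟩ := exists_norm_le_of_injOn (E := L →L[ℝ] L)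
    (F := L →L[ℝ] L →L[ℝ] L) (derivDefect L) (LinearMap.ker P)
    fun Z hPZ hZ => by
      obtain ⟨X, rfl⟩ := exists_adL_eq_of_derivDefect_eq_zero hZ
      rw [LinearMap.mem_ker, hP] at hPZ
      subst hPZ
      ext y
      simp
  have hden : 0 < K * (‖bracketL L‖ + 1) := by positivity
  refine ⟨(K * (‖bracketL L‖ + 1))⁻¹, inv_pos.2 hden, fun Z hPZ hZ hpres => ?_⟩
  -- For an automorphism `1 + Z` the defect of `Z` is exactly `⁅Z x, Z y⁆`, hence quadratic in `Z`.
  -- Off the inner derivations it also bounds `Z` linearly, which forces a small `Z` to vanish.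
  have hbound : ‖derivDefect L Z‖ ≤ (‖bracketL L‖ * ‖Z‖) * ‖Z‖ := by
    refine ContinuousLinearMap.opNorm_le_bound₂ _ (by positivity) fun x y => ?_
    have heq : derivDefect L Z x y = bracketL L (Z x) (Z y) := by
      have := hpres x y
      simp only [add_apply, one_apply_eq_self, lie_add, add_lie] at this
      rw [derivDefect_apply, bracketL_apply, sub_sub, sub_eq_iff_eq_add']
      have h2 := add_left_cancel (a := ⁅x, y⁆) (b := Z ⁅x, y⁆)
        (c := ⁅Z x, y⁆ + ⁅x, Z y⁆ + ⁅Z x, Z y⁆) (by rw [this]; abel)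
      exact h2
    rw [heq]
    calc ‖bracketL L (Z x) (Z y)‖ ≤ ‖bracketL L‖ * ‖Z x‖ * ‖Z y‖ :=
          ContinuousLinearMap.le_opNorm₂ _ _ _
      _ ≤ ‖bracketL L‖ * (‖Z‖ * ‖x‖) * (‖Z‖ * ‖y‖) := by
          gcongr <;> exact ContinuousLinearMap.le_opNorm _ _
      _ = _ := by ring
  have hle : ‖Z‖ ≤ K * ‖derivDefect L Z‖ := hanti Z hPZ
  by_contra h0
  have hpos : 0 < ‖Z‖ := norm_pos_iff.2 h0
  have h1 : ‖Z‖ * 1 ≤ ‖Z‖ * (K * (‖bracketL L‖ + 1) * ‖Z‖) := by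
    calc ‖Z‖ * 1 = ‖Z‖ := mul_one _
      _ ≤ K * ((‖bracketL L‖ * ‖Z‖) * ‖Z‖) := hle.trans (by gcongr)
      _ ≤ K * (((‖bracketL L‖ + 1) * ‖Z‖) * ‖Z‖) := by gcongr; linarith
      _ = _ := by ring
  have h2 := le_of_mul_le_mul_left h1 hpos
  have h3 : K * (‖bracketL L‖ + 1) * ‖Z‖ < 1 := by
    rw [← lt_inv_mul_iff₀ hden, mul_one]
    exact hZ
  exact absurd h2 (not_le.2 h3)

theorem exp_adL_mul_adL_mul (A X : L) :
    exp (adL A) * adL X * exp (-adL A) = adL (exp (adL A) X) := by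
  have := adL_map (g := expAd A) (preservesBracket_exp_adL A) X
  rw [coe_expAd_inv] at this
  exact this.symm

theorem exp_adL_add_of_lie_eq_zero {X Y : L} (h : ⁅X, Y⁆ = 0) :
    exp (adL (X + Y)) = exp (adL X) * exp (adL Y) := by
  let _ : NormedAlgebra ℚ (L →L[ℝ] L) := NormedAlgebra.restrictScalars ℚ ℝ _
  have hc : Commute (adL X) (adL Y) := by
    ext v
    have := leibniz_lie X Y v
    rw [h, zero_lie, zero_add] at this
    exact this
  rw [← adCLM_apply, map_add, adCLM_apply, adCLM_apply, exp_add_of_commute hc]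

theorem analyticAt_exp_adL (X : L) : AnalyticAt ℝ (fun X : L => exp (adL X)) X :=
  (exp_analytic (𝕂 := ℝ) (adL X)).comp ((adCLM L).analyticAt X)

theorem hasFDerivAt_exp_comp {E : Type*} [NormedAddCommGroup E] [NormedSpace ℝ E]
    (T : E →L[ℝ] L →L[ℝ] L) : HasFDerivAt (fun x => exp (T x)) T 0 := by
  have h : HasFDerivAt (exp : (L →L[ℝ] L) → _) (1 : (L →L[ℝ] L) →L[ℝ] _) (T 0) := by
    rw [map_zero]; exact hasFDerivAt_exp_zero
  exact h.comp 0 T.hasFDerivAt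

/-- A regular element `A` of an abelian subalgebra: there is a projection `π` onto the subalgebra
such that `ξ ↦ ξ - exp(ad A) ξ + π ξ` is onto. -/
theorem WeightBasis.exists_projection {a : Submodule ℝ L} {J : Type*} (e : WeightBasis a J)
    (hcent : ∀ X : L, (∀ A ∈ a, ⁅A, X⁆ = 0) → X ∈ a) {A : a}
    (hA : ∀ j, e.weight j ≠ 0 → e.weight j A ≠ 0) :
    ∃ (π : L →ₗ[ℝ] a) (η : L →ₗ[ℝ] L),
      ∀ v, η v - exp (adL (A : L)) (η v) + π (η v) = v := by
  classical
  -- Self-centralization of `a` enters here: the zero weight space is contained in `a`.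
  have hmem : ∀ j, e.weight j = 0 → e.basis j ∈ a := fun j hj =>
    hcent _ fun B hB => by
      have := e.lie_basis ⟨B, hB⟩ j
      rwa [hj, LinearMap.zero_apply, zero_smul] at this
  let π : L →ₗ[ℝ] a := e.basis.constr ℝ fun j =>
    if h : e.weight j = 0 then ⟨e.basis j, hmem j h⟩ else 0
  let r : J → ℝ := fun j => if e.weight j = 0 then 1 else 1 - Real.exp (e.weight j A)
  let η : L →ₗ[ℝ] L := e.basis.constr ℝ fun j => (r j)⁻¹ • e.basis j
  let κ : L →ₗ[ℝ] L := LinearMap.id - ((exp (adL (A : L)) : L →L[ℝ] L) : L →ₗ[ℝ] L) + a.subtype ∘ₗ π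
  have hr : ∀ j, r j ≠ 0 := by
    intro j
    by_cases h : e.weight j = 0
    · simp [r, h]
    · simp only [r, if_neg h]
      rw [sub_ne_zero, ne_comm, Ne, Real.exp_eq_one_iff]
      exact hA j h
  have hκ : ∀ j, κ (e.basis j) = r j • e.basis j := by
    intro j
    have h1 : exp (adL (A : L)) (e.basis j) = Real.exp (e.weight j A) • e.basis j :=
      exp_clm_apply_eigenvector (e.lie_basis A j)
    have h2 : κ (e.basis j) = e.basis j - exp (adL (A : L)) (e.basis j) + π (e.basis j) := rfl
    rw [h2, h1]
    by_cases h : e.weight j = 0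
    · simp [π, r, h]
    · simp [π, r, h, sub_smul]
  have hκη : κ ∘ₗ η = LinearMap.id := by
    refine e.basis.ext fun j => ?_
    simp [η, hκ, smul_smul, inv_mul_cancel₀ (hr j)]
  exact ⟨π, η, fun v => LinearMap.congr_fun hκη v⟩

/-- Automorphisms near `exp (ad A)`, for `A` regular in the self-centralizing abelian subalgebra
`a`, are conjugate to `exp (ad (A + τ))` with `τ ∈ a` depending analytically on the automorphism. -/
theorem exists_analytic_conj [LieAlgebra.IsKilling ℝ L] (hinj : Function.Injective (adL : L → _))
    {a : Submodule ℝ L} (hab : ∀ X ∈ a, ∀ Y ∈ a, ⁅X, Y⁆ = 0) {A : a} (π : L →ₗ[ℝ] a)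
    (η : L →ₗ[ℝ] L) (hη : ∀ v, η v - exp (adL (A : L)) (η v) + π (η v) = v) :
    ∃ (ζ : (L →L[ℝ] L) → L) (τ : (L →L[ℝ] L) → a), AnalyticAt ℝ τ 1 ∧ τ 1 = 0 ∧
      ∀ᶠ φ in 𝓝 (1 : L →L[ℝ] L), PreservesBracket φ → φ * exp (adL (A : L)) =
        exp (adL (ζ φ)) * exp (adL ((A + τ φ : a) : L)) * exp (-adL (ζ φ)) := by
  -- `P` extracts an inner component and `Z` is the complementary projection; `ξ` and `σ` solve the
  -- linearized equation for that component.
  obtain ⟨P₀, hP₀⟩ := LinearMap.exists_leftInverse_of_injective (adCLM L : L →ₗ[ℝ] L →L[ℝ] L)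
    (LinearMap.ker_eq_bot.2 hinj)
  let P : (L →L[ℝ] L) →L[ℝ] L := LinearMap.toContinuousLinearMap P₀
  have hP : ∀ X, P (adL X) = X := fun X => LinearMap.congr_fun hP₀ X
  let ξ : (L →L[ℝ] L) →L[ℝ] L := (LinearMap.toContinuousLinearMap η).comp P
  let σ : (L →L[ℝ] L) →L[ℝ] a := (LinearMap.toContinuousLinearMap π).comp ξ
  let Z : (L →L[ℝ] L) →L[ℝ] L →L[ℝ] L := ContinuousLinearMap.id ℝ _ - (adCLM L).comp P
  let T₁ : (L →L[ℝ] L) →L[ℝ] L →L[ℝ] L := (adCLM L).comp ξ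
  let T₂ : (L →L[ℝ] L) →L[ℝ] L →L[ℝ] L := (adCLM L).comp (a.subtypeL.comp σ)
  set E := exp (adL (A : L)) with hE
  set F := exp (-adL (A : L)) with hF
  have hEF : E * F = 1 := exp_mul_exp_neg_clm _
  -- `M D` is the conjugate of `exp (ad (A + σ D))` by `exp (ad (ξ D))`, times `exp (-ad A)`. The
  -- factor `1 + Z D` fills the directions transversal to `ad L`, making the derivative of `Ψ` at
  -- `0` the identity.
  let M : (L →L[ℝ] L) → L →L[ℝ] L := fun D =>
    exp (T₁ D) * E * exp (T₂ D) * exp ((-T₁) D) * F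
  let Ψ : (L →L[ℝ] L) → L →L[ℝ] L := fun D => M D * (1 + Z D)
  have hfix : ∀ B : a, E B = B := by
    intro B
    have := exp_clm_apply_eigenvector (T := adL (A : L)) (v := (B : L)) (s := 0)
      (by rw [adL_apply, hab _ A.2 _ B.2, zero_smul])
    rw [hE, this, Real.exp_zero, one_smul]
  have hderiv : HasFDerivAt Ψ
      ((ContinuousLinearEquiv.refl ℝ (L →L[ℝ] L) : (L →L[ℝ] L) ≃L[ℝ] _) : _ →L[ℝ] _) 0 := by
    have h1 := hasFDerivAt_exp_comp T₁
    have h2 := hasFDerivAt_exp_comp T₂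
    have h3 := hasFDerivAt_exp_comp (-T₁)
    have h4 : HasFDerivAt (fun D => 1 + Z D) Z 0 := Z.hasFDerivAt.const_add 1
    have h := ((((h1.mul_const' E).mul' h2).mul' h3).mul_const' F).mul' h4
    refine h.congr_fderiv (ContinuousLinearMap.ext fun D => ?_)
    have hT₁ : E * T₁ D * F = adL (E (ξ D)) := exp_adL_mul_adL_mul _ _
    have hT₂ : E * T₂ D * F = adL (σ D : L) := by
      rw [← hfix (σ D)]; exact exp_adL_mul_adL_mul _ _
    have key : T₁ D + adL (σ D : L) - adL (E (ξ D)) + Z D = D := by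
      have h0 := hη (P D)
      have h5 : adCLM L (ξ D) + adCLM L (σ D : L) - adCLM L (E (ξ D)) = adCLM L (P D) := by
        rw [← map_add, ← map_sub]
        congr 1
        rw [← h0]
        simp only [hE, ξ, σ, ContinuousLinearMap.comp_apply, LinearMap.coe_toContinuousLinearMap']
        abel
      have h6 : Z D = D - adCLM L (P D) := rfl
      rw [h6, ← h5]
      simp only [adCLM_apply, T₁, ContinuousLinearMap.comp_apply]
      abel
    simp only [Pi.mul_apply, map_zero, neg_zero, exp_zero, add_apply, smul_apply, smul_eq_mul, one_mul,
      mul_one, add_zero, neg_apply, op_smul_eq_mul, ContinuousLinearEquiv.coe_coe,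
      ContinuousLinearEquiv.coe_refl', id_eq]
    calc E * F * Z D + (E * -T₁ D + (E * T₂ D + T₁ D * E)) * F
        = T₁ D * (E * F) + E * T₂ D * F - E * T₁ D * F + E * F * Z D := by noncomm_ring
      _ = D := by rw [hT₁, hT₂, hEF, mul_one, one_mul, key]
  have hanalytic : AnalyticAt ℝ Ψ 0 := by
    have hexp : ∀ T : (L →L[ℝ] L) →L[ℝ] L →L[ℝ] L, AnalyticAt ℝ (fun D => exp (T D)) 0 := fun T =>
      (exp_analytic (𝕂 := ℝ) (T 0)).comp (T.analyticAt 0)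
    exact (((((hexp T₁).mul analyticAt_const).mul (hexp T₂)).mul (hexp (-T₁))).mul
      analyticAt_const).mul (analyticAt_const.add (Z.analyticAt 0))
  have hΨ0 : Ψ 0 = 1 := by simp [Ψ, M, hEF]
  -- Here `⊤` is analytic regularity, so the local inverse is analytic too.
  have hcd : ContDiffAt ℝ ⊤ Ψ 0 := hanalytic.contDiffAt
  let S := hcd.localInverse hderiv (by simp)
  have hS : AnalyticAt ℝ S 1 := by
    have := hcd.to_localInverse hderiv (by simp)
    rw [hΨ0] at this
    exact this.analyticAt
  have hS1 : S 1 = 0 := by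
    have := hcd.localInverse_apply_image hderiv (by simp)
    rwa [hΨ0] at this
  have hright : ∀ᶠ φ in 𝓝 (1 : L →L[ℝ] L), Ψ (S φ) = φ := by
    have := (hcd.hasStrictFDerivAt' hderiv (by simp)).eventually_right_inverse
    rwa [hΨ0] at this
  obtain ⟨ε, hε, hZ⟩ := exists_norm_lt_eq_zero_of_preservesBracket (L := L) (P := P₀) fun X => LinearMap.congr_fun hP₀ X
  have hsmall : ∀ᶠ φ in 𝓝 (1 : L →L[ℝ] L), ‖Z (S φ)‖ < ε := by
    have : Tendsto (fun φ => ‖Z (S φ)‖) (𝓝 1) (𝓝 ‖Z (S 1)‖) :=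
      (Z.continuous.continuousAt.comp hS.continuousAt).norm
    rw [hS1, map_zero, norm_zero] at this
    exact this.eventually_lt_const hε
  refine ⟨fun φ => ξ (S φ), fun φ => σ (S φ), (σ.analyticAt _).comp hS, by simp [hS1], ?_⟩
  filter_upwards [hright, hsmall] with φ hφ hlt hpres
  set D := S φ
  let m : (L →L[ℝ] L)ˣ := expAd (ξ D) * expAd ((A + σ D : a) : L) * (expAd (ξ D))⁻¹ *
    (expAd (A : L))⁻¹
  have hmem : ∀ X : L, expAd X ∈ adjointGroup L := fun X => Subgroup.subset_closure ⟨X, rfl⟩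
  have hm : m ∈ adjointGroup L := mul_mem (mul_mem (mul_mem (hmem _) (hmem _))
    (inv_mem (hmem _))) (inv_mem (hmem _))
  have hadd : exp (adL ((A + σ D : a) : L)) = E * exp (T₂ D) :=
    exp_adL_add_of_lie_eq_zero (hab _ A.2 _ (σ D).2)
  have hmM : (m : L →L[ℝ] L) = M D := by
    simp only [m, Units.val_mul, coe_expAd, coe_expAd_inv, hadd]
    simp only [M, neg_apply]
    rw [← mul_assoc (exp _) E]
    rfl
  have hZD : 1 + Z D = ((m⁻¹ : (L →L[ℝ] L)ˣ) : L →L[ℝ] L) * φ := by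
    rw [← hφ]
    change _ = ((m⁻¹ : (L →L[ℝ] L)ˣ) : L →L[ℝ] L) * (M D * (1 + Z D))
    rw [← hmM, Units.inv_mul_cancel_left]
  -- `1 + Z D` is the product of two automorphisms, is close to `1` and has no inner component.
  have hZ0 : Z D = 0 := by
    refine hZ (Z D) ?_ hlt ?_
    · change P (D - adL (P D)) = 0
      rw [map_sub, hP, sub_self]
    · rw [hZD]
      exact (preservesBracket_of_mem (inv_mem hm)).mul hpres
  have hφm : φ = m := by
    rw [← hφ, hmM]
    change M D * (1 + Z D) = M D
    rw [hZ0, add_zero, mul_one]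
  rw [hφm, hE, ← coe_expAd, ← Units.val_mul]
  simp only [m, inv_mul_cancel_right, Units.val_mul, coe_expAd, coe_expAd_inv]

end

/-! ### Openness and analyticity -/

section

variable {L : Type*} [NormedLieRing L] [RealNormedLieAlgebra L] [FiniteDimensional ℝ L]

/-- Local normal form: near a purely loxodromic element, all elements of the adjoint group are purely
loxodromic, and their Jordan projection is an analytic function of the translate `Φ`. -/
theorem exists_analytic_jordanProjection (hL : IsSplitRealForm L) {θ : L ≃ₗ⁅ℝ⁆ L}
    (hθ : IsCartanInvolution θ) {a : Submodule ℝ L} (ha : IsMaximalAbelianIn (pPart θ) a)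
    {pos : Module.Dual ℝ a → Prop} (hpos : IsPositivity pos) {x : adjointGroup L}
    (hx : x ∈ purelyLoxodromic a pos) :
    ∃ (g h : (L →L[ℝ] L)ˣ) (f : (L →L[ℝ] L) → a), AnalyticAt ℝ f 1 ∧
      (g : L →L[ℝ] L) * ((x : (L →L[ℝ] L)ˣ) : L →L[ℝ] L) * h = 1 ∧
      ∀ᶠ φ in 𝓝 (1 : L →L[ℝ] L), ∀ y : adjointGroup L,
        (g : L →L[ℝ] L) * ((y : (L →L[ℝ] L)ˣ) : L →L[ℝ] L) * h = φ →
          y ∈ purelyLoxodromic a pos ∧ jordanProjection θ a pos y = f φ := by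
  have hle : a ≤ pPart θ := ha.1.1
  have hab : ∀ X ∈ a, ∀ Y ∈ a, ⁅X, Y⁆ = 0 := ha.1.2
  have _ := hθ.isKilling
  obtain ⟨A, hA, hconj⟩ := hx
  obtain ⟨g, hg⟩ := isConj_iff.1 hconj
  obtain ⟨e⟩ := hθ.nonempty_weightBasis hle hab
  have hfin := e.finite_restrictedRoots
  obtain ⟨π, η, hη⟩ := e.exists_projection (hL.split θ a hθ ha) (A := A) fun j hj =>
    root_ne_zero_of_mem_openChamber hle hfin hpos hA (e.weight_mem_restrictedRoots hj)
  obtain ⟨ζ, τ, hτ, hτ1, hev⟩ := exists_analytic_conj hθ.adL_injective hab π η hη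
  -- The translate is `g * y * g⁻¹ * exp (-A)`, which is `1` at `y = x`, where the normal form is
  -- centred.
  refine ⟨g, ((g⁻¹ * (expG (A : L))⁻¹ : adjointGroup L) : (L →L[ℝ] L)ˣ), fun φ => A + τ φ,
    analyticAt_const.add hτ, ?_, ?_⟩
  · rw [← Units.val_mul, ← Units.val_mul, ← Subgroup.coe_mul, ← Subgroup.coe_mul, ← hg]
    simp only [mul_assoc, mul_inv_rev, inv_inv, mul_inv_cancel_left, inv_mul_cancel_left,
      mul_inv_cancel, Subgroup.coe_one, Units.val_one]
  have hchamber : ∀ᶠ φ in 𝓝 (1 : L →L[ℝ] L), A + τ φ ∈ openChamber a pos := by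
    have : Tendsto (fun φ => A + τ φ) (𝓝 1) (𝓝 (A + τ 1)) :=
      tendsto_const_nhds.add hτ.continuousAt
    rw [hτ1, add_zero] at this
    exact this.eventually ((isOpen_openChamber hfin).mem_nhds hA)
  filter_upwards [hev, hchamber] with φ hφ hmem y hy
  have hpres : PreservesBracket φ := by
    rw [← hy]
    exact preservesBracket_of_mem (g * y * (g⁻¹ * (expG (A : L))⁻¹)).2
  have hy2 : g * y * g⁻¹ = expG (ζ φ) * expG ((A + τ φ : a) : L) * (expG (ζ φ))⁻¹ := by
    have h1 : g * y * (g⁻¹ * (expG (A : L))⁻¹) * expG (A : L) =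
        expG (ζ φ) * expG ((A + τ φ : a) : L) * (expG (ζ φ))⁻¹ := by
      refine Subtype.ext (Units.ext ?_)
      have h2 := hφ hpres
      rw [← coe_expAd_inv] at h2
      exact (congrArg (· * exp (adL (A : L))) hy).trans h2
    rw [← h1]
    group
  have hyconj : IsConj y (expG ((A + τ φ : a) : L)) := by
    refine isConj_iff.2 ⟨(expG (ζ φ))⁻¹ * g, ?_⟩
    calc (expG (ζ φ))⁻¹ * g * y * ((expG (ζ φ))⁻¹ * g)⁻¹
        = (expG (ζ φ))⁻¹ * (g * y * g⁻¹) * expG (ζ φ) := by group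
      _ = expG ((A + τ φ : a) : L) := by rw [hy2]; group
  have hyU : y ∈ purelyLoxodromic a pos := ⟨_, hmem, hyconj⟩
  exact ⟨hyU, (jordanProjection_spec θ a pos y hyU).eq_of_isConj hθ hle hab hpos
    (subset_closure hmem) hyconj⟩

end

end SplitGroup

end

/-- Let `L` be a split real form of a complex simple Lie algebra and `G = Int L` the corresponding
split real form of the complex adjoint group. For every Cartan involution `θ`, every maximal abelian
subspace `a` of its `-1` eigenspace and every ordering, the set of purely loxodromic elements of `G`
is open, and the Jordan projection is real analytic on it. -/
theorem lemma3p3 {L : Type*} [SplitGroup.NormedLieRing L] [SplitGroup.RealNormedLieAlgebra L]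
    [FiniteDimensional ℝ L] (hL : SplitGroup.IsSplitRealForm L)
    (θ : L ≃ₗ⁅ℝ⁆ L) (hθ : SplitGroup.IsCartanInvolution θ)
    (a : Submodule ℝ L) (ha : SplitGroup.IsMaximalAbelianIn (SplitGroup.pPart θ) a)
    (pos : Module.Dual ℝ a → Prop) (hpos : SplitGroup.IsPositivity pos) :
    IsOpen (SplitGroup.purelyLoxodromic a pos) ∧
      SplitGroup.RealAnalyticOn (SplitGroup.jordanProjection θ a pos)
        (SplitGroup.purelyLoxodromic a pos) := by
  refine ⟨isOpen_iff_mem_nhds.2 fun x hx => ?_, fun x hx => ?_⟩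
  · obtain ⟨g, h, f, -, hx1, hev⟩ :=
      SplitGroup.exists_analytic_jordanProjection hL hθ ha hpos hx
    have hcont : Continuous fun y : SplitGroup.adjointGroup L =>
        (g : L →L[ℝ] L) * ((y : (L →L[ℝ] L)ˣ) : L →L[ℝ] L) * h :=
      (continuous_const.mul (Units.continuous_val.comp continuous_subtype_val)).mul
        continuous_const
    have ht := hcont.tendsto x
    rw [hx1] at ht
    filter_upwards [ht.eventually hev] with y hy using (hy y rfl).1
  · obtain ⟨g, h, f, hf, hx1, hev⟩ :=
      SplitGroup.exists_analytic_jordanProjection hL hθ ha hpos hx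
    have han : AnalyticAt ℝ (fun X : L => (g : L →L[ℝ] L) *
        (((x * SplitGroup.expG X : SplitGroup.adjointGroup L) : (L →L[ℝ] L)ˣ) : L →L[ℝ] L) * h)
        0 :=
      (analyticAt_const.mul (analyticAt_const.mul (SplitGroup.analyticAt_exp_adL 0))).mul
        analyticAt_const
    have h0 : (g : L →L[ℝ] L) * (((x * SplitGroup.expG (0 : L) : SplitGroup.adjointGroup L) :
        (L →L[ℝ] L)ˣ) : L →L[ℝ] L) * h = 1 := by
      have : SplitGroup.expG (0 : L) = 1 := by
        refine Subtype.ext (Units.ext ?_)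
        change NormedSpace.exp (SplitGroup.adCLM L 0) = 1
        rw [map_zero, NormedSpace.exp_zero]
      rw [this, mul_one, hx1]
    have ht := han.continuousAt.tendsto
    rw [h0] at ht
    -- In the exponential chart at `x`, the Jordan projection is `f` composed with an analytic map
    -- into operators.
    refine (AnalyticAt.fun_comp (by rwa [h0]) han).congr ?_
    filter_upwards [ht.eventually hev] with X hX using ((hX _ rfl).2).symm
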